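/- **Setting.** A Bayesian RL problem has state and action spaces $\mathcal S,\mathcal A$ with base probability measures $\mu_{\mathcal S},\mu_{\mathcal A}$, an episode length $H$, and a fixed initial state $s_1$. An environment is $\mathcal E=\{(P_h,r_h)\}_{h=1}^H$, where $P_h(\cdot|s,a)$ is a probability density with respect to $\mu_{\mathcal S}$ and $r_h(\cdot|s,a)$ is a probability density on $[0,1]$ with respect to Lebesgue measure. The environment space is $\Theta=\prod_{h}(\Theta_h^P\times\Theta_h^R)$, with countably generated $\sigma$-algebras for which evaluation is measurable, and the prior $\rho$ is a product of priors on all the factors $\Theta_h^P,\Theta_h^R$. For a stationary policy $\pi$ (whose action laws have densities with respect to $\mu_{\mathcal A}$) let $V^{\mathcal E}_{1,\pi}(s_1)$ be the expectation of $\sum_{h=1}^H r_h(s_h,a_h)$ (mean rewards) along the trajectory of $\pi$ in $\mathcal E$ from $s_1$. Let $\mathcal E\mapsto\pi^*_{\mathcal E}$ be a measurable choice, for $\mathcal E\in\Theta$, of an optimal policy within a given policy class $\Pi$. Let $\mathcal D_\ell$ be the history of the first $\ell-1$ episodes of Thompson sampling, and let $\mathbb P_\ell=\mathbb P(\,\cdot\,|\mathcal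 D_\ell)$ be (a regular version of) the posterior of $\mathcal E$. Let $\varepsilon>0$. An *$\varepsilon$-value partition* is a partition of $\Theta$ into measurable cells $\Theta_1,\dots,\Theta_K$ such that $V^{\mathcal E}_{1,\pi^*_{\mathcal E}}(s_1)-V^{\mathcal E'}_{1,\pi^*_{\mathcal E}}(s_1)\le\varepsilon$ whenever $\mathcal E,\mathcal E'$ lie in the same cell. It is *layered* if, under the prior conditioned on any cell of positive prior probability, the layers $(P_h,r_h)$, $h=1,\dots,H$, are independent. Put $\zeta(\mathcal E)=k$ if $\mathcal E\in\Theta_k$. For a choice of environments $\tilde{\mathcal E}_{k,\ell}$ ($k\le K$) that depend measurably on $\mathcal D_\ell$, consider the random environment $\tilde{\mathcal E}^*_\ell=\tilde{\mathcal E}_{\zeta(\mathcal E),\ell}$, a function of $\zeta$ and $\mathcal D_\ell$ only, and the inequality $$\mathbb E_\ell\!\left[V^{\mathcal E}_{1,\pi^*_{\mathcal E}}(s_1)-V^{\mathcal E}_{1,\pi^*_{\mathcal E'}}(s_1)\right]-\mathbb E_\ell\!\left[V^{\tilde{\mathcal E}^*_\ell}_{1,\pi^*_{\mathcal E}}(s_1)-V^{\tilde{\mathcal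 E}^*_\ell}_{1,\pi^*_{\mathcal E'}}(s_1)\right]\le\varepsilon, \qquad (*)$$ where $\mathcal E,\mathcal E'$ are independent with law $\mathbb P_\ell$ and $\pi^\ell_{\mathrm{TS}}=\pi^*_{\mathcal E'}$ is the Thompson sampling policy. **Lemma.** Let an $\varepsilon$-value partition and an episode $\ell\ge1$ be given. 1. There are environments $\tilde{\mathcal E}_{k,\ell}\in\Theta$, depending measurably on $\mathcal D_\ell$, with $\tilde{\mathcal E}_{k,\ell}\in\Theta_k$ whenever $\Theta_k\neq\emptyset$, such that $(*)$ holds for almost every $\mathcal D_\ell$. 2. If the partition is layered, then there are environments $\tilde{\mathcal E}_{k,\ell}$ (not necessarily elements of $\Theta$), depending measurably on $\mathcal D_\ell$, such that $\tilde{\mathcal E}_{k,\ell}$ is the posterior mean over $\Theta_k$ whenever $\mathbb P_\ell(\Theta_k)>0$, i.e. its densities are $\mathbb E_\ell[P_h^{\mathcal E}(\cdot|s,a)\mid\mathcal E\in\Theta_k]$ and $\mathbb E_\ell[r_h^{\mathcal E}(\cdot|s,a)\mid\mathcal E\in\Theta_k]$, and such that $(*)$ holds for almost every $\mathcal D_\ell$.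 -/

import Mathlib

open MeasureTheory ProbabilityTheory
open scoped ENNReal

/-- A transition function `P_h : S × A → Δ_{S, μS}` given by its densities
`dens s a s' = P_h(s' | s, a)` with respect to the base measure `μS`. -/
structure TransitionFn {S : Type*} (A : Type*) [MeasurableSpace S] [MeasurableSpace A]
    (μS : Measure S) where
  dens : S → A → S → ℝ≥0∞
  measurable_dens : Measurable fun z : S × A × S => dens z.1 z.2.1 z.2.2
  lintegral_dens : ∀ s a, ∫⁻ s', dens s a s' ∂μS = 1

/-- A reward function `r_h : S × A → Δ_{[0,1], Lebesgue}` given by its densities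
`dens s a x = r_h(x | s, a)`. -/
structure RewardFn (S A : Type*) [MeasurableSpace S] [MeasurableSpace A] where
  dens : S → A → ℝ → ℝ≥0∞
  measurable_dens : Measurable fun z : S × A × ℝ => dens z.1 z.2.1 z.2.2
  lintegral_dens : ∀ s a, ∫⁻ x in Set.Icc (0 : ℝ) 1, dens s a x = 1

/-- One layer `π_h : S → Δ_{A, μA}` of a stationary policy, given by its densities
`dens s a = π_h(a | s)`. -/
structure PolicyFn (S : Type*) {A : Type*} [MeasurableSpace S] [MeasurableSpace A]
    (μA : Measure A) where
  dens : S → A → ℝ≥0∞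
  measurable_dens : Measurable fun z : S × A => dens z.1 z.2
  lintegral_dens : ∀ s, ∫⁻ a, dens s a ∂μA = 1

section MDP

variable {S A : Type*} [MeasurableSpace S] [MeasurableSpace A]

/-- The conditional law of the reward given the state and the action. -/
noncomputable def RewardFn.law (r : RewardFn S A) (s : S) (a : A) : Measure ℝ :=
  (volume.restrict (Set.Icc (0 : ℝ) 1)).withDensity (r.dens s a)

/-- The mean reward `r(s, a) = ∫₀¹ x r(x | s, a) dx`. -/
noncomputable def RewardFn.mean (r : RewardFn S A) (s : S) (a : A) : ℝ :=
  ∫ x, x ∂(r.law s a)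

/-- The conditional law of the next state given the state and the action. -/
noncomputable def TransitionFn.law {μS : Measure S} (P : TransitionFn A μS) (s : S) (a : A) :
    Measure S :=
  μS.withDensity (P.dens s a)

/-- The conditional law of the action given the state. -/
noncomputable def PolicyFn.law {μA : Measure A} (π : PolicyFn S μA) (s : S) : Measure A :=
  μA.withDensity (π.dens s)

/-- An environment with `m` layers: a transition function and a reward function per layer. -/
abbrev Env (A : Type*) [MeasurableSpace A] (μS : Measure S) (m : ℕ) : Type _ :=
  Fin m → TransitionFn A μS × RewardFn S A

/-- A stationary policy with `m` layers. -/
abbrev Policy (S : Type*) [MeasurableSpace S] (μA : Measure A) (m : ℕ) : Type _ :=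
  Fin m → PolicyFn S μA

/-- A trajectory `(s_1, a_1, r_1, …, s_m, a_m, r_m)`. -/
abbrev Traj (S A : Type*) (m : ℕ) : Type _ := Fin m → S × A × ℝ

/-- The law of the trajectory of the policy `π` in the environment `E`, started from the state `s`:
in every layer the action is drawn from the policy, the reward and the next state from the
environment. -/
noncomputable def trajLaw {μS : Measure S} {μA : Measure A} :
    {m : ℕ} → Env A μS m → Policy S μA m → S → Measure (Traj S A m)
  | 0, _, _, _ => Measure.dirac Fin.elim0
  | m + 1, E, π, s =>
      ((π 0).law s).bind fun a =>
        ((E 0).2.law s a).bind fun x =>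
          ((E 0).1.law s a).bind fun s' =>
            (trajLaw (fun j : Fin m => E j.succ) (fun j : Fin m => π j.succ) s').map
              fun τ => (Fin.cons (s, a, x) τ : Traj S A (m + 1))

/-- The expectation of the sum of the mean rewards `∑ r_h(s_h, a_h)` along the trajectory of `π` in
`E` started from `s`. -/
noncomputable def expectedReturn {μS : Measure S} {μA : Measure A} {m : ℕ} (E : Env A μS m)
    (π : Policy S μA m) (s : S) : ℝ :=
  ∫ τ, ∑ j, (E j).2.mean (τ j).1 (τ j).2.1 ∂(trajLaw E π s)

/-- Forget the first `h` of `H` layers. -/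
def dropLayers {H : ℕ} {α : Type*} (f : Fin H → α) (h : ℕ) : Fin (H - h) → α :=
  fun j => f ⟨h + j, by omega⟩

/-- The value function `V_{h, π}^E(s) = 𝔼_π^E[∑_{h' ≥ h} r_{h'}(s_{h'}, a_{h'}) | s_h = s]`. Layers
are counted from `0`, so that `value E π 0` is the value function of the whole episode, and
`value E π H` is zero. -/
noncomputable def value {μS : Measure S} {μA : Measure A} {H : ℕ} (E : Env A μS H)
    (π : Policy S μA H) (h : ℕ) (s : S) : ℝ :=
  expectedReturn (dropLayers E h) (dropLayers π h) s

end MDP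

/-- A Bayesian reinforcement learning problem with episode length `H`: base probability measures on
the state and the action space, an initial state, for every layer a space of transition functions
and a space of reward functions, each with a (countably generated) `σ`-algebra for which evaluation
is measurable and with a prior, a policy class, and a measurable choice
of an optimal policy in that class for every environment. -/
structure BayesianRL (S A : Type*) [MeasurableSpace S] [MeasurableSpace A] (H : ℕ) where
  μS : Measure S
  isProb_μS : IsProbabilityMeasure μS
  μA : Measure A
  isProb_μA : IsProbabilityMeasure μA
  /-- the initial state -/
  s₁ : S
  /-- the transition functions of layer `h` -/
  ΘP : Fin H → Set (TransitionFn A μS)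
  /-- the reward functions of layer `h` -/
  ΘR : Fin H → Set (RewardFn S A)
  measΘP : ∀ h, MeasurableSpace (ΘP h)
  measΘR : ∀ h, MeasurableSpace (ΘR h)
  countablyGenerated_ΘP : ∀ h, MeasurableSpace.CountablyGenerated (ΘP h)
  countablyGenerated_ΘR : ∀ h, MeasurableSpace.CountablyGenerated (ΘR h)
  measurable_evalP : ∀ h, Measurable fun z : ΘP h × S × A × S =>
    z.1.1.dens z.2.1 z.2.2.1 z.2.2.2
  measurable_evalR : ∀ h, Measurable fun z : ΘR h × S × A × ℝ =>
    z.1.1.dens z.2.1 z.2.2.1 z.2.2.2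
  /-- the priors -/
  ρP : ∀ h, Measure (ΘP h)
  ρR : ∀ h, Measure (ΘR h)
  isProb_ρP : ∀ h, IsProbabilityMeasure (ρP h)
  isProb_ρR : ∀ h, IsProbabilityMeasure (ρR h)
  /-- the policy class `Π` -/
  policies : Set (Policy S μA H)
  /-- the optimal policy `π*_E` of an environment -/
  opt : (∀ h, ΘP h × ΘR h) → Policy S μA H
  measurable_opt : ∀ h, Measurable fun z : (∀ h, ΘP h × ΘR h) × S × A =>
    (opt z.1 h).dens z.2.1 z.2.2
  opt_mem : ∀ θ, opt θ ∈ policies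
  opt_isMax : ∀ θ, ∀ π ∈ policies, ∀ (h : ℕ) (s : S),
    value (fun j => ((θ j).1.1, (θ j).2.1)) π h s
      ≤ value (fun j => ((θ j).1.1, (θ j).2.1)) (opt θ) h s

namespace BayesianRL

variable {S A : Type*} [MeasurableSpace S] [MeasurableSpace A] {H : ℕ}

attribute [instance] isProb_μS isProb_μA measΘP measΘR countablyGenerated_ΘP
  countablyGenerated_ΘR isProb_ρP isProb_ρR

/-- The environment space `Θ = Θ_1 × ⋯ × Θ_H` with `Θ_h = Θ_h^P × Θ_h^R`. -/
abbrev Θ (M : BayesianRL S A H) : Type _ := ∀ h, M.ΘP h × M.ΘR h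

/-- An element of `Θ` as an environment. -/
def env (M : BayesianRL S A H) (θ : M.Θ) : Env A M.μS H := fun h => ((θ h).1.1, (θ h).2.1)

/-- The prior: all transition and reward functions are independent. -/
noncomputable def prior (M : BayesianRL S A H) : Measure M.Θ :=
  Measure.pi fun h => (M.ρP h).prod (M.ρR h)

/-- The value `V_{1, π}^E(s_1)` of a policy in an environment from the initial state. -/
noncomputable def V (M : BayesianRL S A H) (E : Env A M.μS H) (π : Policy S M.μA H) : ℝ :=
  value E π 0 M.s₁

/-- The histories of `n` complete episodes. -/
abbrev Hist (_M : BayesianRL S A H) (n : ℕ) : Type _ := Fin n → Traj S A H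

/-- The joint law of the history of the first `n` episodes and the true environment, when the
environment is drawn from the prior and the agent acts in episode `n + 1`, given the history `d`,
according to the optimal policy of a fresh sample from `Q n d`. -/
noncomputable def jointLaw (M : BayesianRL S A H) (Q : ∀ n, Kernel (M.Hist n) M.Θ) :
    (n : ℕ) → Measure (M.Hist n × M.Θ)
  | 0 => M.prior.map fun θ => (Fin.elim0, θ)
  | n + 1 =>
      (jointLaw M Q n).bind fun z =>
        (Q n z.1).bind fun θ' =>
          (trajLaw (M.env z.2) (M.opt θ') M.s₁).map fun τ => (Fin.snoc z.1 τ, z.2)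

/-- The law of the history of the first `n` episodes. -/
noncomputable def histLaw (M : BayesianRL S A H) (Q : ∀ n, Kernel (M.Hist n) M.Θ) (n : ℕ) :
    Measure (M.Hist n) :=
  (M.jointLaw Q n).fst

/-- `Q n` is the posterior given the history of the first `n` episodes, that is, a regular
conditional distribution of the true environment given that history, where the agent runs Thompson
sampling with these posteriors. -/
def IsPosterior (M : BayesianRL S A H) (Q : ∀ n, Kernel (M.Hist n) M.Θ) : Prop :=
  ∀ n, IsMarkovKernel (Q n) ∧ M.jointLaw Q n = (M.histLaw Q n).compProd (Q n)

/-- The partition of `Θ` into the cells `Θ_k = ζ⁻¹{k}` is an `ε`-value partition. -/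
def IsValuePartition (M : BayesianRL S A H) (ε : ℝ) {K : ℕ} (ζ : M.Θ → Fin K) : Prop :=
  Measurable ζ ∧
    ∀ θ θ' : M.Θ, ζ θ = ζ θ' → M.V (M.env θ) (M.opt θ) - M.V (M.env θ') (M.opt θ) ≤ ε

/-- The partition is layered: conditionally on the cell, the layers of the environment are
independent under the prior. -/
def IsLayered (M : BayesianRL S A H) {K : ℕ} (ζ : M.Θ → Fin K) : Prop :=
  ∀ k, M.prior (ζ ⁻¹' {k}) ≠ 0 →
    iIndepFun (fun (h : Fin H) (θ : M.Θ) => θ h) (M.prior[|ζ ⁻¹' {k}])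

/-- The expected regret of Thompson sampling in the true environment, when `q` is the posterior: the
true environment and the sampled environment are independent with law `q`. -/
noncomputable def tsRegret (M : BayesianRL S A H) (q : Measure M.Θ) : ℝ :=
  ∫ z : M.Θ × M.Θ, (M.V (M.env z.1) (M.opt z.1) - M.V (M.env z.1) (M.opt z.2)) ∂(q.prod q)

/-- The expected regret of Thompson sampling in the surrogate environment, which takes the value
`E k` when the true environment lies in the cell `k`. -/
noncomputable def surrogateRegret (M : BayesianRL S A H) (q : Measure M.Θ) {K : ℕ}
    (ζ : M.Θ → Fin K) (E : Fin K → Env A M.μS H) : ℝ :=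
  ∫ z : M.Θ × M.Θ, (M.V (E (ζ z.1)) (M.opt z.1) - M.V (E (ζ z.1)) (M.opt z.2)) ∂(q.prod q)

/-- `E` is the mean of the environments under the measure `q`: its densities are the means of the
densities. -/
def IsMeanEnv (M : BayesianRL S A H) (q : Measure M.Θ) (E : Env A M.μS H) : Prop :=
  ∀ h s a,
    (∀ s', (E h).1.dens s a s' = ∫⁻ θ, (M.env θ h).1.dens s a s' ∂q) ∧
    (∀ x, (E h).2.dens s a x = ∫⁻ θ, (M.env θ h).2.dens s a x ∂q)

/-- An environment that depends measurably on the history. -/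
def MeasurableEnv (M : BayesianRL S A H) {n : ℕ} (E : M.Hist n → Env A M.μS H) : Prop :=
  ∀ h,
    (Measurable fun z : M.Hist n × S × A × S => (E z.1 h).1.dens z.2.1 z.2.2.1 z.2.2.2) ∧
    (Measurable fun z : M.Hist n × S × A × ℝ => (E z.1 h).2.dens z.2.1 z.2.2.1 z.2.2.2)

end BayesianRL

/-! After regrouping, the left side of the inequality is the mean of the change in value of the
optimal policy when the true environment is replaced by the surrogate, minus the same change for the
sampled policy (`tsRegret_sub_surrogateRegret_le`). The first change should be at most `ε` by the
partition property. The second should have nonnegative mean, which is arranged cell by cell: the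
surrogate of a cell must not give the sampled policies more, on average, than the environments of
that cell do.

For surrogates inside `Θ`, let `g θ` be the mean value in `θ` of a policy sampled from the
posterior. In a cell of positive posterior mass, `g` is at most its cell average on a set of
positive posterior measure, hence of positive prior measure by Bayes' rule. No topology on `Θ` is
needed to pick such a point measurably in the history: sections of positive measure are met, almost
surely, by countably many fixed points (`exists_seq_ae_mem_section`).

For posterior means, the value of a fixed policy is affine in each layer of the environment
separately. If the layers are independent, the mean value is therefore the value of the mean
environment (`lintegral_lreturn_pi`), so the second change averages to zero and the first inherits
the bound `ε` by averaging. Independence given the cell passes from prior to posterior because the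
likelihood is a product over layers: the agent's action densities do not involve the true
environment, and the rest of the trajectory density factors (`lintegral_trajLaw_eq`,
`exists_jointLaw_eq_withDensity`, `exists_eq_pi_of_iIndepFun`). -/

/-! ### Measures depending measurably on a parameter. -/

section Kernels

variable {X Y Z : Type*} [MeasurableSpace X] [MeasurableSpace Y] [MeasurableSpace Z]

theorem measurable_lintegral_param {κ : X → Measure Y} (hκ : Measurable κ)
    [∀ x, IsProbabilityMeasure (κ x)] {f : X → Y → ℝ≥0∞} (hf : Measurable (Function.uncurry f)) :
    Measurable fun x => ∫⁻ y, f x y ∂(κ x) := by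
  let k : Kernel X Y := ⟨κ, hκ⟩
  have : IsMarkovKernel k := ⟨fun x => inferInstanceAs (IsProbabilityMeasure (κ x))⟩
  exact Measurable.lintegral_kernel_prod_right (κ := k) hf

theorem measurable_bind_param {κ : X → Measure Y} (hκ : Measurable κ)
    [∀ x, IsProbabilityMeasure (κ x)] {η : X → Y → Measure Z}
    (hη : Measurable (Function.uncurry η)) : Measurable fun x => (κ x).bind (η x) := by
  refine Measure.measurable_of_measurable_coe _ fun s hs => ?_
  have h : ∀ x, ((κ x).bind (η x)) s = ∫⁻ y, η x y s ∂(κ x) := fun x =>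
    Measure.bind_apply hs (hη.of_uncurry_left).aemeasurable
  simp_rw [h]
  exact measurable_lintegral_param hκ ((Measure.measurable_coe hs).comp hη)

theorem measurable_map_param {κ : X → Measure Y} (hκ : Measurable κ)
    [∀ x, IsProbabilityMeasure (κ x)] {f : X → Y → Z} (hf : Measurable (Function.uncurry f)) :
    Measurable fun x => (κ x).map (f x) := by
  have h : ∀ x, (κ x).map (f x) = (κ x).bind fun y => Measure.dirac (f x y) := fun x =>
    (Measure.bind_dirac_eq_map _ hf.of_uncurry_left).symm
  simp_rw [h]
  exact measurable_bind_param hκ (Measure.measurable_dirac.comp hf)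

theorem measurable_withDensity_param {μ : Measure Y} [SFinite μ] {f : X → Y → ℝ≥0∞}
    (hf : Measurable (Function.uncurry f)) : Measurable fun x => μ.withDensity (f x) := by
  refine Measure.measurable_of_measurable_coe _ fun s hs => ?_
  simp_rw [withDensity_apply _ hs]
  exact Measurable.lintegral_prod_right' (f := fun z : X × Y => f z.1 z.2) hf

theorem isProbabilityMeasure_bind_param {μ : Measure X} [IsProbabilityMeasure μ]
    {κ : X → Measure Y} (hκ : Measurable κ) (hp : ∀ x, IsProbabilityMeasure (κ x)) :
    IsProbabilityMeasure (μ.bind κ) :=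
  ⟨by rw [Measure.bind_apply .univ hκ.aemeasurable]; simp⟩

theorem measurable_finCons {n : ℕ} :
    Measurable fun z : Y × (Fin n → Y) => (Fin.cons z.1 z.2 : Fin (n + 1) → Y) := by
  refine measurable_pi_iff.2 fun i => ?_
  refine Fin.cases ?_ (fun j => ?_) i
  · simpa using measurable_fst
  · simpa using by fun_prop

theorem measurable_finSnoc {n : ℕ} :
    Measurable fun z : (Fin n → Y) × Y => (Fin.snoc z.1 z.2 : Fin (n + 1) → Y) := by
  refine measurable_pi_iff.2 fun i => ?_
  refine Fin.lastCases ?_ (fun j => ?_) i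
  · simpa using measurable_snd
  · simpa using by fun_prop

end Kernels

/-! ### Measurability and one-step unrolling of the trajectory law. -/

section MDP

variable {S A : Type*} [MeasurableSpace S] [MeasurableSpace A] {μS : Measure S} {μA : Measure A}
  {T : Type*} [MeasurableSpace T] {m : ℕ}

/-- Environments that depend measurably on a parameter. -/
def MeasurableEnvFamily (E : T → Env A μS m) : Prop :=
  ∀ h,
    (Measurable fun z : T × S × A × S => (E z.1 h).1.dens z.2.1 z.2.2.1 z.2.2.2) ∧
    (Measurable fun z : T × S × A × ℝ => (E z.1 h).2.dens z.2.1 z.2.2.1 z.2.2.2)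

/-- Policies that depend measurably on a parameter. -/
def MeasurablePolicyFamily (π : T → Policy S μA m) : Prop :=
  ∀ h, Measurable fun z : T × S × A => (π z.1 h).dens z.2.1 z.2.2

theorem measurableEnvFamily_const (E : Env A μS m) : MeasurableEnvFamily fun _ : T => E := fun h =>
  ⟨(E h).1.measurable_dens.comp measurable_snd, (E h).2.measurable_dens.comp measurable_snd⟩

theorem measurablePolicyFamily_const (π : Policy S μA m) :
    MeasurablePolicyFamily fun _ : T => π := fun h =>
  (π h).measurable_dens.comp measurable_snd

theorem MeasurableEnvFamily.comp {E : T → Env A μS m} (hE : MeasurableEnvFamily E) {U : Type*}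
    [MeasurableSpace U] {g : U → T} (hg : Measurable g) : MeasurableEnvFamily fun u => E (g u) :=
  fun h => ⟨(hE h).1.comp (f := fun z : U × S × A × S => (g z.1, z.2)) (by fun_prop),
    (hE h).2.comp (f := fun z : U × S × A × ℝ => (g z.1, z.2)) (by fun_prop)⟩

theorem MeasurablePolicyFamily.comp {π : T → Policy S μA m} (hπ : MeasurablePolicyFamily π)
    {U : Type*} [MeasurableSpace U] {g : U → T} (hg : Measurable g) :
    MeasurablePolicyFamily fun u => π (g u) :=
  fun h => (hπ h).comp (f := fun z : U × S × A => (g z.1, z.2)) (by fun_prop)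

theorem MeasurableEnvFamily.tail {E : T → Env A μS (m + 1)} (hE : MeasurableEnvFamily E) :
    MeasurableEnvFamily fun t => fun j : Fin m => E t j.succ := fun h => hE h.succ

theorem MeasurablePolicyFamily.tail {π : T → Policy S μA (m + 1)}
    (hπ : MeasurablePolicyFamily π) :
    MeasurablePolicyFamily fun t => fun j : Fin m => π t j.succ := fun h => hπ h.succ

theorem PolicyFn.measurable_dens_right (π : PolicyFn S μA) (s : S) : Measurable (π.dens s) :=
  π.measurable_dens.comp measurable_prodMk_left

theorem TransitionFn.measurable_dens_right (P : TransitionFn A μS) (s : S) (a : A) :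
    Measurable (P.dens s a) :=
  P.measurable_dens.comp (f := fun s' => (s, a, s')) (by fun_prop)

theorem RewardFn.measurable_dens_right (r : RewardFn S A) (s : S) (a : A) :
    Measurable (r.dens s a) :=
  r.measurable_dens.comp (f := fun x => (s, a, x)) (by fun_prop)

instance PolicyFn.isProbabilityMeasure_law (π : PolicyFn S μA) (s : S) :
    IsProbabilityMeasure (π.law s) :=
  ⟨by rw [PolicyFn.law, withDensity_apply _ .univ, Measure.restrict_univ, π.lintegral_dens]⟩

instance TransitionFn.isProbabilityMeasure_law (P : TransitionFn A μS) (s : S) (a : A) :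
    IsProbabilityMeasure (P.law s a) :=
  ⟨by rw [TransitionFn.law, withDensity_apply _ .univ, Measure.restrict_univ, P.lintegral_dens]⟩

instance RewardFn.isProbabilityMeasure_law (r : RewardFn S A) (s : S) (a : A) :
    IsProbabilityMeasure (r.law s a) :=
  ⟨by rw [RewardFn.law, withDensity_apply _ .univ, Measure.restrict_univ, r.lintegral_dens]⟩

theorem MeasurablePolicyFamily.measurable_law [SFinite μA] {π : T → Policy S μA m}
    (hπ : MeasurablePolicyFamily π) (h : Fin m) :
    Measurable fun z : T × S => (π z.1 h).law z.2 :=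
  measurable_withDensity_param (f := fun z : T × S => (π z.1 h).dens z.2)
    ((hπ h).comp (f := fun z : (T × S) × A => (z.1.1, z.1.2, z.2)) (by fun_prop))

theorem MeasurableEnvFamily.measurable_transition_law [SFinite μS] {E : T → Env A μS m}
    (hE : MeasurableEnvFamily E) (h : Fin m) :
    Measurable fun z : T × S × A => (E z.1 h).1.law z.2.1 z.2.2 :=
  measurable_withDensity_param (f := fun z : T × S × A => (E z.1 h).1.dens z.2.1 z.2.2)
    ((hE h).1.comp (f := fun z : (T × S × A) × S => (z.1.1, z.1.2.1, z.1.2.2, z.2)) (by fun_prop))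

theorem MeasurableEnvFamily.measurable_reward_law {E : T → Env A μS m}
    (hE : MeasurableEnvFamily E) (h : Fin m) :
    Measurable fun z : T × S × A => (E z.1 h).2.law z.2.1 z.2.2 :=
  measurable_withDensity_param (f := fun z : T × S × A => (E z.1 h).2.dens z.2.1 z.2.2)
    ((hE h).2.comp (f := fun z : (T × S × A) × ℝ => (z.1.1, z.1.2.1, z.1.2.2, z.2)) (by fun_prop))

/-- The two claims go through one induction, because measurability of a `bind` or `map` in its
parameter is available here only for probability measures. -/
theorem measurable_trajLaw_and_isProbabilityMeasure [SFinite μS] [SFinite μA]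
    {E : T → Env A μS m} {π : T → Policy S μA m}
    (hE : MeasurableEnvFamily E) (hπ : MeasurablePolicyFamily π) :
    (Measurable fun z : T × S => trajLaw (E z.1) (π z.1) z.2) ∧
      ∀ t s, IsProbabilityMeasure (trajLaw (E t) (π t) s) := by
  induction m with
  | zero =>
    exact ⟨by simp only [trajLaw]; exact measurable_const, fun t s => by
      simp only [trajLaw]; infer_instance⟩
  | succ m ih =>
    obtain ⟨hm, hp⟩ := ih hE.tail hπ.tail
    -- The nested draws are treated from the inside out; `w` collects the parameter and everything
    -- drawn before the current stage (state, action, reward, next state).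
    have h4 : Measurable fun w : (((T × S) × A) × ℝ) × S =>
        (trajLaw (fun j : Fin m => E w.1.1.1.1 j.succ) (fun j : Fin m => π w.1.1.1.1 j.succ)
          w.2).map fun τ => (Fin.cons (w.1.1.1.2, w.1.1.2, w.1.2) τ : Traj S A (m + 1)) := by
      refine measurable_map_param (κ := fun w : (((T × S) × A) × ℝ) × S =>
        trajLaw (fun j : Fin m => E w.1.1.1.1 j.succ) (fun j : Fin m => π w.1.1.1.1 j.succ) w.2)
        (hm.comp (f := fun w : (((T × S) × A) × ℝ) × S => (w.1.1.1.1, w.2)) (by fun_prop)) ?_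
      exact measurable_finCons.comp (f := fun z : ((((T × S) × A) × ℝ) × S) × Traj S A m =>
        ((z.1.1.1.1.2, z.1.1.1.2, z.1.1.2), z.2)) (by fun_prop)
    have p4 : ∀ w : (((T × S) × A) × ℝ) × S, IsProbabilityMeasure
        ((trajLaw (fun j : Fin m => E w.1.1.1.1 j.succ) (fun j : Fin m => π w.1.1.1.1 j.succ)
          w.2).map fun τ => (Fin.cons (w.1.1.1.2, w.1.1.2, w.1.2) τ : Traj S A (m + 1))) :=
      fun w => Measure.isProbabilityMeasure_map
        (measurable_finCons.comp measurable_prodMk_left).aemeasurable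
    have h3 := measurable_bind_param
      (κ := fun w : ((T × S) × A) × ℝ => (E w.1.1.1 0).1.law w.1.1.2 w.1.2)
      ((hE.measurable_transition_law 0).comp
        (f := fun w : ((T × S) × A) × ℝ => (w.1.1.1, w.1.1.2, w.1.2)) (by fun_prop))
      (η := fun w s' => (trajLaw (fun j : Fin m => E w.1.1.1 j.succ)
        (fun j : Fin m => π w.1.1.1 j.succ) s').map
          fun τ => (Fin.cons (w.1.1.2, w.1.2, w.2) τ : Traj S A (m + 1))) h4
    have p3 := fun w : ((T × S) × A) × ℝ => isProbabilityMeasure_bind_param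
      (μ := (E w.1.1.1 0).1.law w.1.1.2 w.1.2)
      (κ := fun s' => (trajLaw (fun j : Fin m => E w.1.1.1 j.succ)
        (fun j : Fin m => π w.1.1.1 j.succ) s').map
          fun τ => (Fin.cons (w.1.1.2, w.1.2, w.2) τ : Traj S A (m + 1)))
      (h4.comp (measurable_prodMk_left (x := w))) (fun s' => p4 (w, s'))
    have h2 := measurable_bind_param
      (κ := fun w : (T × S) × A => (E w.1.1 0).2.law w.1.2 w.2)
      ((hE.measurable_reward_law 0).comp
        (f := fun w : (T × S) × A => (w.1.1, w.1.2, w.2)) (by fun_prop))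
      (η := fun w x => ((E w.1.1 0).1.law w.1.2 w.2).bind fun s' =>
        (trajLaw (fun j : Fin m => E w.1.1 j.succ)
        (fun j : Fin m => π w.1.1 j.succ) s').map
          fun τ => (Fin.cons (w.1.2, w.2, x) τ : Traj S A (m + 1))) h3
    have p2 := fun w : (T × S) × A => isProbabilityMeasure_bind_param
      (μ := (E w.1.1 0).2.law w.1.2 w.2)
      (κ := fun x => ((E w.1.1 0).1.law w.1.2 w.2).bind fun s' =>
        (trajLaw (fun j : Fin m => E w.1.1 j.succ)
        (fun j : Fin m => π w.1.1 j.succ) s').map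
          fun τ => (Fin.cons (w.1.2, w.2, x) τ : Traj S A (m + 1)))
      (by simpa only [Function.comp_def] using h3.comp (measurable_prodMk_left (x := w)))
      (fun x => p3 (w, x))
    have h1 := measurable_bind_param (κ := fun z : T × S => (π z.1 0).law z.2)
      (hπ.measurable_law 0)
      (η := fun w a => ((E w.1 0).2.law w.2 a).bind fun x => ((E w.1 0).1.law w.2 a).bind fun s' =>
        (trajLaw (fun j : Fin m => E w.1 j.succ) (fun j : Fin m => π w.1 j.succ) s').map
          fun τ => (Fin.cons (w.2, a, x) τ : Traj S A (m + 1))) h2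
    refine ⟨by simpa only [trajLaw] using h1, fun t s => ?_⟩
    rw [trajLaw]
    refine isProbabilityMeasure_bind_param (μ := (π t 0).law s) ?_ (fun a => p2 ((t, s), a))
    simpa only [Function.comp_def] using h2.comp (measurable_prodMk_left (x := (t, s)))

theorem measurable_trajLaw [SFinite μS] [SFinite μA] {E : T → Env A μS m} {π : T → Policy S μA m}
    (hE : MeasurableEnvFamily E) (hπ : MeasurablePolicyFamily π) :
    Measurable fun z : T × S => trajLaw (E z.1) (π z.1) z.2 :=
  (measurable_trajLaw_and_isProbabilityMeasure hE hπ).1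

instance isProbabilityMeasure_trajLaw [SFinite μS] [SFinite μA] (E : Env A μS m)
    (π : Policy S μA m) (s : S) : IsProbabilityMeasure (trajLaw E π s) :=
  (measurable_trajLaw_and_isProbabilityMeasure (T := Unit) (measurableEnvFamily_const E)
    (measurablePolicyFamily_const π)).2 () s

theorem lintegral_trajLaw_succ [SFinite μS] [SFinite μA] (E : Env A μS (m + 1))
    (π : Policy S μA (m + 1)) (s : S) {f : Traj S A (m + 1) → ℝ≥0∞} (hf : Measurable f) :
    ∫⁻ τ, f τ ∂(trajLaw E π s) =
      ∫⁻ a, ∫⁻ x, ∫⁻ s', ∫⁻ τ, f (Fin.cons (s, a, x) τ)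
        ∂(trajLaw (fun j : Fin m => E j.succ) (fun j : Fin m => π j.succ) s')
        ∂((E 0).1.law s a) ∂((E 0).2.law s a) ∂((π 0).law s) := by
  have hE := measurableEnvFamily_const (T := A × ℝ) E
  have hm : Measurable fun s' => trajLaw (fun j : Fin m => E j.succ) (fun j : Fin m => π j.succ) s' :=
    (measurable_trajLaw (measurableEnvFamily_const (T := Unit) fun j : Fin m => E j.succ)
      (measurablePolicyFamily_const fun j : Fin m => π j.succ)).comp
      (measurable_prodMk_left (x := ()))
  have h4 : Measurable fun w : (A × ℝ) × S =>
      (trajLaw (fun j : Fin m => E j.succ) (fun j : Fin m => π j.succ) w.2).map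
        fun τ => (Fin.cons (s, w.1.1, w.1.2) τ : Traj S A (m + 1)) := by
    refine measurable_map_param (κ := fun w : (A × ℝ) × S =>
      trajLaw (fun j : Fin m => E j.succ) (fun j : Fin m => π j.succ) w.2)
      (hm.comp measurable_snd) ?_
    exact measurable_finCons.comp (f := fun z : ((A × ℝ) × S) × Traj S A m =>
        ((s, z.1.1.1, z.1.1.2), z.2)) (by fun_prop)
  have h3 := measurable_bind_param (κ := fun w : A × ℝ => (E 0).1.law s w.1)
    ((hE.measurable_transition_law 0).comp (f := fun w : A × ℝ => (w, s, w.1)) (by fun_prop))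
    (η := fun w s' => (trajLaw (fun j : Fin m => E j.succ) (fun j : Fin m => π j.succ) s').map
        fun τ => (Fin.cons (s, w.1, w.2) τ : Traj S A (m + 1))) h4
  have h2 := measurable_bind_param (κ := fun a : A => (E 0).2.law s a)
    (((measurableEnvFamily_const (T := A) E).measurable_reward_law 0).comp
      (f := fun a : A => (a, s, a)) (by fun_prop))
    (η := fun a x => ((E 0).1.law s a).bind fun s' =>
      (trajLaw (fun j : Fin m => E j.succ) (fun j : Fin m => π j.succ) s').map
        fun τ => (Fin.cons (s, a, x) τ : Traj S A (m + 1))) h3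
  rw [trajLaw, Measure.lintegral_bind h2.aemeasurable hf.aemeasurable]
  refine lintegral_congr fun a => ?_
  refine (Measure.lintegral_bind (h3.comp (measurable_prodMk_left (x := a))).aemeasurable
    hf.aemeasurable).trans ?_
  refine lintegral_congr fun x => ?_
  refine (Measure.lintegral_bind (h4.comp (measurable_prodMk_left (x := (a, x)))).aemeasurable
    hf.aemeasurable).trans ?_
  refine lintegral_congr fun s' => ?_
  exact lintegral_map hf (measurable_finCons.comp measurable_prodMk_left)

end MDP

/-! ### The expected return by backward recursion. -/

section Return

variable {S A : Type*} [MeasurableSpace S] [MeasurableSpace A] {μS : Measure S} {μA : Measure A}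
  {T : Type*} [MeasurableSpace T] {m : ℕ}

/-- The mean reward as an extended nonnegative number. -/
noncomputable def RewardFn.lmean (r : RewardFn S A) (s : S) (a : A) : ℝ≥0∞ :=
  ∫⁻ x in Set.Icc (0 : ℝ) 1, r.dens s a x * ENNReal.ofReal x

theorem RewardFn.lintegral_law (r : RewardFn S A) (s : S) (a : A) :
    ∫⁻ x, ENNReal.ofReal x ∂(r.law s a) = r.lmean s a :=
  lintegral_withDensity_eq_lintegral_mul _ (r.measurable_dens_right s a) (by fun_prop)

theorem RewardFn.lmean_le_one (r : RewardFn S A) (s : S) (a : A) : r.lmean s a ≤ 1 := by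
  rw [← r.lintegral_dens s a]
  refine setLIntegral_mono (r.measurable_dens_right s a) fun x hx => ?_
  exact mul_le_of_le_one_right' (by simpa using hx.2)

theorem RewardFn.mean_eq (r : RewardFn S A) (s : S) (a : A) :
    r.mean s a = (r.lmean s a).toReal := by
  rw [RewardFn.mean, integral_eq_lintegral_of_nonneg_ae _ (by fun_prop), RewardFn.lintegral_law]
  exact (withDensity_absolutelyContinuous _ _).ae_le
    ((ae_restrict_iff' measurableSet_Icc).2 (ae_of_all _ fun x hx => hx.1))

theorem MeasurableEnvFamily.measurable_lmean {E : T → Env A μS m} (hE : MeasurableEnvFamily E)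
    (h : Fin m) : Measurable fun z : T × S × A => (E z.1 h).2.lmean z.2.1 z.2.2 := by
  refine Measurable.lintegral_prod_right'
    (f := fun z : (T × S × A) × ℝ => (E z.1.1 h).2.dens z.1.2.1 z.1.2.2 z.2 * ENNReal.ofReal z.2) ?_
  exact ((hE h).2.comp (f := fun z : (T × S × A) × ℝ => (z.1.1, z.1.2.1, z.1.2.2, z.2))
    (by fun_prop)).mul (by fun_prop)

/-- The expected return by backward recursion, as an extended nonnegative number. -/
noncomputable def lreturn : {m : ℕ} → Env A μS m → Policy S μA m → S → ℝ≥0∞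
  | 0, _, _, _ => 0
  | _ + 1, E, π, s =>
      ∫⁻ a, (π 0).dens s a * ((E 0).2.lmean s a + ∫⁻ s', (E 0).1.dens s a s' *
        lreturn (fun j => E j.succ) (fun j => π j.succ) s' ∂μS) ∂μA

theorem measurable_lreturn [SFinite μS] [SFinite μA] {E : T → Env A μS m} {π : T → Policy S μA m}
    (hE : MeasurableEnvFamily E) (hπ : MeasurablePolicyFamily π) :
    Measurable fun z : T × S => lreturn (E z.1) (π z.1) z.2 := by
  induction m with
  | zero => simp only [lreturn]; exact measurable_const
  | succ m ih =>
    simp only [lreturn]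
    refine Measurable.lintegral_prod_right' (f := fun z : (T × S) × A =>
      (π z.1.1 0).dens z.1.2 z.2 * ((E z.1.1 0).2.lmean z.1.2 z.2 +
        ∫⁻ s', (E z.1.1 0).1.dens z.1.2 z.2 s' *
        lreturn (fun j => E z.1.1 j.succ) (fun j => π z.1.1 j.succ) s' ∂μS)) ?_
    refine ((hπ 0).comp (f := fun z : (T × S) × A => (z.1.1, z.1.2, z.2)) (by fun_prop)).mul
      (((hE.measurable_lmean 0).comp (f := fun z : (T × S) × A => (z.1.1, z.1.2, z.2))
        (by fun_prop)).add ?_)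
    refine Measurable.lintegral_prod_right' (f := fun w : ((T × S) × A) × S =>
      (E w.1.1.1 0).1.dens w.1.1.2 w.1.2 w.2 *
        lreturn (fun j => E w.1.1.1 j.succ) (fun j => π w.1.1.1 j.succ) w.2) ?_
    exact ((hE 0).1.comp (f := fun w : ((T × S) × A) × S => (w.1.1.1, w.1.1.2, w.1.2, w.2))
      (by fun_prop)).mul ((ih hE.tail hπ.tail).comp
        (f := fun w : ((T × S) × A) × S => (w.1.1.1, w.2)) (by fun_prop))

theorem measurable_lreturn_right [SFinite μS] [SFinite μA] (E : Env A μS m) (π : Policy S μA m) :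
    Measurable (lreturn E π) :=
  (measurable_lreturn (measurableEnvFamily_const (T := Unit) E)
    (measurablePolicyFamily_const π)).comp (measurable_prodMk_left (x := ()))

theorem measurable_sum_lmean (E : Env A μS m) :
    Measurable fun τ : Traj S A m => ∑ j, (E j).2.lmean (τ j).1 (τ j).2.1 := by
  refine Finset.measurable_sum _ fun j _ => ?_
  exact ((measurableEnvFamily_const (T := Unit) E).measurable_lmean j).comp
    (f := fun τ : Traj S A m => ((), (τ j).1, (τ j).2.1)) (by fun_prop)

/-- The summands depend on states and actions only, so the sampled reward integrates out. The
recursive form makes the affine dependence on each layer visible, which averaging over environments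
exploits. -/
theorem lintegral_sum_lmean [SFinite μS] [SFinite μA] (E : Env A μS m) (π : Policy S μA m)
    (s : S) : ∫⁻ τ, ∑ j, (E j).2.lmean (τ j).1 (τ j).2.1 ∂(trajLaw E π s) = lreturn E π s := by
  induction m generalizing s with
  | zero => simp [lreturn]
  | succ m ih =>
    rw [lintegral_trajLaw_succ E π s (measurable_sum_lmean E), lreturn]
    have htail := measurable_lreturn_right (fun j => E j.succ) (fun j => π j.succ)
    have key : ∀ a, (∫⁻ x, ∫⁻ s', ∫⁻ τ, ∑ j, (E j).2.lmean
        ((Fin.cons (s, a, x) τ : Traj S A (m + 1)) j).1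
        ((Fin.cons (s, a, x) τ : Traj S A (m + 1)) j).2.1
        ∂(trajLaw (fun j : Fin m => E j.succ) (fun j : Fin m => π j.succ) s')
        ∂((E 0).1.law s a) ∂((E 0).2.law s a)) = (E 0).2.lmean s a + ∫⁻ s', (E 0).1.dens s a s' *
        lreturn (fun j => E j.succ) (fun j => π j.succ) s' ∂μS := by
      intro a
      have h : ∀ s' x, ∫⁻ τ, ∑ j, (E j).2.lmean
          ((Fin.cons (s, a, x) τ : Traj S A (m + 1)) j).1
          ((Fin.cons (s, a, x) τ : Traj S A (m + 1)) j).2.1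
          ∂(trajLaw (fun j : Fin m => E j.succ) (fun j : Fin m => π j.succ) s') =
          (E 0).2.lmean s a + lreturn (fun j => E j.succ) (fun j => π j.succ) s' := by
        intro s' x
        simp only [Fin.sum_univ_succ, Fin.cons_zero, Fin.cons_succ]
        rw [lintegral_add_left measurable_const, ih]
        simp
      simp only [h, lintegral_const, measure_univ, mul_one]
      rw [lintegral_add_left measurable_const]
      simp only [lintegral_const, measure_univ, mul_one]
      congr 1
      exact lintegral_withDensity_eq_lintegral_mul _ ((E 0).1.measurable_dens_right s a) htail
    simp only [key]
    refine lintegral_withDensity_eq_lintegral_mul _ ((π 0).measurable_dens_right s) ?_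
    refine (((measurableEnvFamily_const (T := Unit) E).measurable_lmean 0).comp
      (f := fun a : A => ((), s, a)) (by fun_prop)).add ?_
    refine Measurable.lintegral_prod_right' (f := fun w : A × S => (E 0).1.dens s w.1 w.2 *
        lreturn (fun j => E j.succ) (fun j => π j.succ) w.2) ?_
    exact ((E 0).1.measurable_dens.comp (f := fun w : A × S => (s, w.1, w.2))
      (by fun_prop)).mul (htail.comp measurable_snd)

theorem lreturn_le [SFinite μS] [SFinite μA] (E : Env A μS m) (π : Policy S μA m) (s : S) :
    lreturn E π s ≤ m := by
  rw [← lintegral_sum_lmean]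
  calc _ ≤ ∫⁻ _, (m : ℝ≥0∞) ∂(trajLaw E π s) := lintegral_mono fun τ => by
        simpa using Finset.sum_le_sum (s := Finset.univ) fun j _ =>
          (E j).2.lmean_le_one (τ j).1 (τ j).2.1
    _ = m := by simp

theorem lreturn_ne_top [SFinite μS] [SFinite μA] (E : Env A μS m) (π : Policy S μA m) (s : S) :
    lreturn E π s ≠ ∞ :=
  ((lreturn_le E π s).trans_lt (ENNReal.natCast_lt_top m)).ne

theorem expectedReturn_eq [SFinite μS] [SFinite μA] (E : Env A μS m) (π : Policy S μA m) (s : S) :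
    expectedReturn E π s = (lreturn E π s).toReal := by
  have h : ∀ τ : Traj S A m, ∑ j, (E j).2.mean (τ j).1 (τ j).2.1 =
      (∑ j, (E j).2.lmean (τ j).1 (τ j).2.1).toReal := fun τ => by
    rw [ENNReal.toReal_sum fun j _ => ((RewardFn.lmean_le_one _ _ _).trans_lt ENNReal.one_lt_top).ne]
    simp only [RewardFn.mean_eq]
  rw [expectedReturn, ← lintegral_sum_lmean]
  simp only [h]
  refine integral_toReal (measurable_sum_lmean E).aemeasurable (ae_of_all _ fun τ => ?_)
  exact ENNReal.sum_lt_top.2 fun j _ => (RewardFn.lmean_le_one _ _ _).trans_lt ENNReal.one_lt_top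

namespace BayesianRL

variable {H : ℕ}

theorem V_eq (M : BayesianRL S A H) (E : Env A M.μS H) (π : Policy S M.μA H) :
    M.V E π = (lreturn E π M.s₁).toReal := by
  rw [← expectedReturn_eq]
  -- `H - 0` is `H` by definition, so only the index shift `0 + j = j` has to be removed.
  have h : ∀ {α : Type _} (f : Fin H → α), (dropLayers f 0 : Fin H → α) = f := fun f => by
    funext j
    exact congrArg f (Fin.ext (Nat.zero_add _))
  exact congrArg₂ (fun (E : Env A M.μS H) (π : Policy S M.μA H) => expectedReturn E π M.s₁)
    (h E) (h π)

theorem measurableEnvFamily_env (M : BayesianRL S A H) : MeasurableEnvFamily M.env := fun h =>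
  ⟨(M.measurable_evalP h).comp (f := fun z : M.Θ × S × A × S => ((z.1 h).1, z.2)) (by fun_prop),
    (M.measurable_evalR h).comp (f := fun z : M.Θ × S × A × ℝ => ((z.1 h).2, z.2)) (by fun_prop)⟩

theorem measurablePolicyFamily_opt (M : BayesianRL S A H) : MeasurablePolicyFamily M.opt :=
  M.measurable_opt

end BayesianRL

end Return

/-! ### The density of the trajectory law, factored over layers. -/

section Density

variable {S A : Type*} [MeasurableSpace S] [MeasurableSpace A] {μS : Measure S} {μA : Measure A}
  {T : Type*} [MeasurableSpace T] {m : ℕ}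

theorem PolicyFn.ae_dens_lt_top (π : PolicyFn S μA) (s : S) : ∀ᵐ a ∂μA, π.dens s a < ∞ :=
  ae_lt_top (π.measurable_dens_right s) (by rw [π.lintegral_dens]; exact ENNReal.one_ne_top)

/-- An almost everywhere finite density allows an arbitrary `g`, so nested integrals can be
rewritten without proving them measurable. -/
theorem PolicyFn.lintegral_law_eq (π : PolicyFn S μA) (s : S) (g : A → ℝ≥0∞) :
    ∫⁻ a, g a ∂(π.law s) = ∫⁻ a, π.dens s a * g a ∂μA :=
  lintegral_withDensity_eq_lintegral_mul_non_measurable _ (π.measurable_dens_right s)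
    (π.ae_dens_lt_top s) g

theorem TransitionFn.lintegral_law_eq (P : TransitionFn A μS) (s : S) (a : A) (g : S → ℝ≥0∞) :
    ∫⁻ s', g s' ∂(P.law s a) = ∫⁻ s', P.dens s a s' * g s' ∂μS :=
  lintegral_withDensity_eq_lintegral_mul_non_measurable _ (P.measurable_dens_right s a)
    (ae_lt_top (P.measurable_dens_right s a)
      (by rw [P.lintegral_dens]; exact ENNReal.one_ne_top)) g

theorem RewardFn.lintegral_law_eq (r : RewardFn S A) (s : S) (a : A) (g : ℝ → ℝ≥0∞) :
    ∫⁻ x, g x ∂(r.law s a) = ∫⁻ x in Set.Icc (0 : ℝ) 1, r.dens s a x * g x :=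
  lintegral_withDensity_eq_lintegral_mul_non_measurable _ (r.measurable_dens_right s a)
    (ae_lt_top (r.measurable_dens_right s a)
      (by rw [r.lintegral_dens]; exact ENNReal.one_ne_top)) g

variable (μS A) in
/-- The environment in which states and rewards follow the base measures. -/
def uniformEnv [IsProbabilityMeasure μS] (m : ℕ) : Env A μS m := fun _ =>
  (⟨fun _ _ _ => 1, measurable_const, by simp⟩, ⟨fun _ _ _ => 1, measurable_const, by simp⟩)

variable (S μA) in
/-- The policy that draws actions from the base measure. -/
def uniformPolicy [IsProbabilityMeasure μA] (m : ℕ) : Policy S μA m := fun _ =>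
  ⟨fun _ _ => 1, measurable_const, by simp⟩

variable (μS μA) in
/-- The base measure on trajectories started from a given state. -/
noncomputable def trajBase [IsProbabilityMeasure μS] [IsProbabilityMeasure μA] (m : ℕ) (s : S) :
    Measure (Traj S A m) :=
  trajLaw (uniformEnv A μS m) (uniformPolicy S μA m) s

instance [IsProbabilityMeasure μS] [IsProbabilityMeasure μA] (s : S) :
    IsProbabilityMeasure (trajBase μS μA m s) := isProbabilityMeasure_trajLaw _ _ _

theorem measurable_trajBase [IsProbabilityMeasure μS] [IsProbabilityMeasure μA] :
    Measurable (trajBase μS μA m) :=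
  (measurable_trajLaw (measurableEnvFamily_const (T := Unit) (uniformEnv A μS m))
    (measurablePolicyFamily_const (uniformPolicy S μA m))).comp (measurable_prodMk_left (x := ()))

theorem lintegral_trajBase_succ [IsProbabilityMeasure μS] [IsProbabilityMeasure μA] (s : S)
    {f : Traj S A (m + 1) → ℝ≥0∞} (hf : Measurable f) :
    ∫⁻ τ, f τ ∂(trajBase μS μA (m + 1) s) =
      ∫⁻ a, ∫⁻ x in Set.Icc (0 : ℝ) 1, ∫⁻ s', ∫⁻ τ, f (Fin.cons (s, a, x) τ)
        ∂(trajBase μS μA m s') ∂μS ∂volume ∂μA := by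
  rw [trajBase, lintegral_trajLaw_succ _ _ _ hf, PolicyFn.lintegral_law_eq]
  simp only [RewardFn.lintegral_law_eq, TransitionFn.lintegral_law_eq]
  simp only [uniformEnv, uniformPolicy, one_mul]
  rfl

/-- The factor of the density of a trajectory that stems from a layer of the environment. -/
noncomputable def layerDens (h : Fin m) (τ : Traj S A m) (e : TransitionFn A μS × RewardFn S A) :
    ℝ≥0∞ :=
  e.2.dens (τ h).1 (τ h).2.1 (τ h).2.2 *
    if hh : (h : ℕ) + 1 < m then e.1.dens (τ h).1 (τ h).2.1 (τ ⟨h + 1, hh⟩).1 else 1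

theorem layerDens_succ (h : Fin m) (y : S × A × ℝ) (τ : Traj S A m)
    (e : TransitionFn A μS × RewardFn S A) :
    layerDens h.succ (Fin.cons y τ : Traj S A (m + 1)) e = layerDens h τ e := by
  unfold layerDens
  congr 1
  by_cases hh : (h : ℕ) + 1 < m
  · rw [dif_pos hh, dif_pos (by simpa using hh)]
    rfl
  · rw [dif_neg hh, dif_neg (by simpa using hh)]

theorem measurable_layerDens {X : Type*} [MeasurableSpace X]
    {e : X → TransitionFn A μS × RewardFn S A}
    (hP : Measurable fun z : X × S × A × S => (e z.1).1.dens z.2.1 z.2.2.1 z.2.2.2)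
    (hR : Measurable fun z : X × S × A × ℝ => (e z.1).2.dens z.2.1 z.2.2.1 z.2.2.2) (h : Fin m) :
    Measurable fun z : X × Traj S A m => layerDens h z.2 (e z.1) := by
  unfold layerDens
  refine Measurable.mul ?_ ?_
  · exact hR.comp
      (f := fun z : X × Traj S A m => (z.1, (z.2 h).1, (z.2 h).2.1, (z.2 h).2.2)) (by fun_prop)
  · split_ifs with hh
    · exact hP.comp (f := fun z : X × Traj S A m =>
        (z.1, (z.2 h).1, (z.2 h).2.1, (z.2 ⟨h + 1, hh⟩).1)) (by fun_prop)
    · exact measurable_const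

/-- The factor of the density of a trajectory that stems from the policy. -/
noncomputable def policyDens (π : Policy S μA m) (τ : Traj S A m) : ℝ≥0∞ :=
  ∏ h, (π h).dens (τ h).1 (τ h).2.1

theorem MeasurablePolicyFamily.measurable_policyDens {π : T → Policy S μA m}
    (hπ : MeasurablePolicyFamily π) :
    Measurable fun z : T × Traj S A m => policyDens (π z.1) z.2 :=
  Finset.measurable_prod _ fun h _ =>
    (hπ h).comp (f := fun z : T × Traj S A m => (z.1, (z.2 h).1, (z.2 h).2.1)) (by fun_prop)

theorem MeasurableEnvFamily.measurable_prod_layerDens {E : T → Env A μS m}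
    (hE : MeasurableEnvFamily E) :
    Measurable fun z : T × Traj S A m => ∏ h, layerDens h z.2 (E z.1 h) :=
  Finset.measurable_prod _ fun h _ => measurable_layerDens (e := fun t => E t h) (hE h).1 (hE h).2 h

/-- Under `trajBase` started from `s`, the first recorded state is `s` itself. -/
theorem lintegral_trajBase_mul_head [IsProbabilityMeasure μS] [IsProbabilityMeasure μA] (s : S)
    {f : Traj S A (m + 1) → ℝ≥0∞} (hf : Measurable f) {g : S → ℝ≥0∞} (hg : Measurable g) :
    ∫⁻ τ, g (τ 0).1 * f τ ∂(trajBase μS μA (m + 1) s) =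
      g s * ∫⁻ τ, f τ ∂(trajBase μS μA (m + 1) s) := by
  rw [← lintegral_const_mul _ hf, lintegral_trajBase_succ _ (hf.const_mul _),
    lintegral_trajBase_succ _ (by fun_prop)]
  simp only [Fin.cons_zero]

/-- With a layer left, `s'` is the first state of the remaining trajectory. With none left, `s'` is
not recorded and its density integrates to one, which is why the last layer carries no transition
factor in `layerDens`. -/
theorem lintegral_transition_trajBase [IsProbabilityMeasure μS] [IsProbabilityMeasure μA]
    (P : TransitionFn A μS) (s : S) (a : A) {f : Traj S A m → ℝ≥0∞} (hf : Measurable f) :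
    ∫⁻ s', P.dens s a s' * ∫⁻ τ, f τ ∂(trajBase μS μA m s') ∂μS =
      ∫⁻ s', ∫⁻ τ, (if hh : 0 < m then P.dens s a (τ ⟨0, hh⟩).1 else 1) * f τ
        ∂(trajBase μS μA m s') ∂μS := by
  cases m with
  | zero =>
    simp only [trajBase, trajLaw, lt_self_iff_false, dite_false, one_mul]
    rw [lintegral_mul_const _ (P.measurable_dens_right s a), P.lintegral_dens]
    simp
  | succ m =>
    refine lintegral_congr fun s' => ?_
    rw [← lintegral_trajBase_mul_head s' hf (P.measurable_dens_right s a)]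
    simp

/-- The reference measure depends on neither `E` nor `π`, and the density splits into a policy
factor and one factor per layer of the environment. This is the source of the product form of the
likelihood. -/
theorem lintegral_trajLaw_eq [IsProbabilityMeasure μS] [IsProbabilityMeasure μA] (E : Env A μS m)
    (π : Policy S μA m) (s : S) {f : Traj S A m → ℝ≥0∞} (hf : Measurable f) :
    ∫⁻ τ, f τ ∂(trajLaw E π s) =
      ∫⁻ τ, policyDens π τ * (∏ h, layerDens h τ (E h)) * f τ ∂(trajBase μS μA m s) := by
  induction m generalizing s with
  | zero => simp [policyDens, trajBase, trajLaw]
  | succ m ih =>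
    have hπm : ∀ {m : ℕ} (π : Policy S μA m), Measurable (policyDens π) := fun π =>
      (measurablePolicyFamily_const (T := Unit) π).measurable_policyDens.comp
        (measurable_prodMk_left (x := ()))
    have hEm : ∀ {m : ℕ} (E : Env A μS m), Measurable fun τ : Traj S A m =>
        ∏ h, layerDens h τ (E h) := fun E =>
      (measurableEnvFamily_const (T := Unit) E).measurable_prod_layerDens.comp
        (measurable_prodMk_left (x := ()))
    have hm : Measurable fun τ => policyDens π τ * (∏ h, layerDens h τ (E h)) * f τ :=
      ((hπm π).mul (hEm E)).mul hf
    rw [lintegral_trajLaw_succ E π s hf, lintegral_trajBase_succ s hm, PolicyFn.lintegral_law_eq]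
    refine lintegral_congr_ae ?_
    -- A finite constant may be moved into an integral whose integrand is not known to be
    -- measurable.
    filter_upwards [(π 0).ae_dens_lt_top s] with a ha
    rw [RewardFn.lintegral_law_eq, ← lintegral_const_mul' _ _ ha.ne]
    refine lintegral_congr fun x => ?_
    have hfc : Measurable fun τ : Traj S A m => f (Fin.cons (s, a, x) τ) :=
      hf.comp (measurable_finCons.comp measurable_prodMk_left)
    -- `G` is the weighted integrand of the remaining layers, as produced by the induction
    -- hypothesis; the factors of layer `0` are split off in `h2`.
    set G : Traj S A m → ℝ≥0∞ := fun τ => policyDens (fun j => π j.succ) τ *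
      (∏ h, layerDens h τ (E h.succ)) * f (Fin.cons (s, a, x) τ) with hG
    have hGm : Measurable G := ((hπm _).mul (hEm fun j => E j.succ)).mul hfc
    have h1 : ∀ s', ∫⁻ τ, f (Fin.cons (s, a, x) τ)
        ∂(trajLaw (fun j : Fin m => E j.succ) (fun j : Fin m => π j.succ) s') =
        ∫⁻ τ, G τ ∂(trajBase μS μA m s') := fun s' => ih _ _ s' hfc
    have hnext : Measurable fun τ : Traj S A m =>
        (if hh : 0 < m then (E 0).1.dens s a (τ ⟨0, hh⟩).1 else 1) := by
      split_ifs with hh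
      · exact ((E 0).1.measurable_dens_right s a).comp (by fun_prop)
      · exact measurable_const
    have h2 : ∀ τ : Traj S A m, policyDens π (Fin.cons (s, a, x) τ : Traj S A (m + 1)) *
        (∏ h, layerDens h (Fin.cons (s, a, x) τ : Traj S A (m + 1)) (E h)) *
          f (Fin.cons (s, a, x) τ) =
        ((π 0).dens s a * (E 0).2.dens s a x) *
          ((if hh : 0 < m then (E 0).1.dens s a (τ ⟨0, hh⟩).1 else 1) * G τ) := by
      intro τ
      have h3 : layerDens 0 (Fin.cons (s, a, x) τ : Traj S A (m + 1)) (E 0) =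
          (E 0).2.dens s a x *
            (if hh : 0 < m then (E 0).1.dens s a (τ ⟨0, hh⟩).1 else 1) := by
        unfold layerDens
        congr 1
        by_cases hh : 0 < m
        · rw [dif_pos hh, dif_pos (by simpa using hh)]
          rfl
        · rw [dif_neg hh, dif_neg (by simpa using hh)]
      rw [policyDens, Fin.prod_univ_succ, Fin.prod_univ_succ, h3]
      simp only [layerDens_succ, Fin.cons_zero, Fin.cons_succ, hG, policyDens]
      ring
    simp only [h1, h2]
    rw [TransitionFn.lintegral_law_eq, lintegral_transition_trajBase _ _ _ hGm, ← mul_assoc]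
    have hm' : Measurable fun τ =>
      (if hh : 0 < m then (E 0).1.dens s a (τ ⟨0, hh⟩).1 else 1) * G τ := hnext.mul hGm
    simp_rw [lintegral_const_mul _ hm']
    rw [lintegral_const_mul]
    exact measurable_lintegral_param measurable_trajBase
      (f := fun _ τ => (if hh : 0 < m then (E 0).1.dens s a (τ ⟨0, hh⟩).1 else 1) * G τ)
      (hm'.comp measurable_snd)

end Density

/-! ### Likelihood and the joint law of history and environment. -/

namespace BayesianRL

variable {S A : Type*} [MeasurableSpace S] [MeasurableSpace A] {H : ℕ} (M : BayesianRL S A H)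

instance isProbabilityMeasure_prior : IsProbabilityMeasure M.prior := by
  unfold prior; infer_instance

/-- The likelihood of the layer `h` given a history, up to factors that do not depend on the
environment. -/
noncomputable def layerLikelihood {n : ℕ} (h : Fin H) (d : M.Hist n) (e : M.ΘP h × M.ΘR h) : ℝ≥0∞ :=
  ∏ i, layerDens h (d i) (e.1.1, e.2.1)

theorem measurable_layerDens_env (h : Fin H) :
    Measurable fun z : (M.ΘP h × M.ΘR h) × Traj S A H =>
      layerDens h z.2 ((z.1.1.1, z.1.2.1) : TransitionFn A M.μS × RewardFn S A) :=
  measurable_layerDens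
    (e := fun x : M.ΘP h × M.ΘR h => ((x.1.1, x.2.1) : TransitionFn A M.μS × RewardFn S A))
    ((M.measurable_evalP h).comp
      (f := fun z : (M.ΘP h × M.ΘR h) × S × A × S => (z.1.1, z.2)) (by fun_prop))
    ((M.measurable_evalR h).comp
      (f := fun z : (M.ΘP h × M.ΘR h) × S × A × ℝ => (z.1.2, z.2)) (by fun_prop)) h

theorem measurable_layerLikelihood {n : ℕ} (h : Fin H) :
    Measurable fun z : M.Hist n × (M.ΘP h × M.ΘR h) => M.layerLikelihood h z.1 z.2 :=
  Finset.measurable_prod _ fun i _ => (M.measurable_layerDens_env h).comp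
    (f := fun z : M.Hist n × (M.ΘP h × M.ΘR h) => (z.2, z.1 i)) (by fun_prop)

/-- The likelihood of an environment given a history, up to a factor that does not depend on the
environment. -/
noncomputable def likelihood {n : ℕ} (d : M.Hist n) (θ : M.Θ) : ℝ≥0∞ :=
  ∏ h, M.layerLikelihood h d (θ h)

theorem measurable_likelihood {n : ℕ} :
    Measurable fun z : M.Hist n × M.Θ => M.likelihood z.1 z.2 :=
  Finset.measurable_prod _ fun h _ => (M.measurable_layerLikelihood h).comp
    (f := fun z : M.Hist n × M.Θ => (z.1, z.2 h)) (by fun_prop)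

theorem likelihood_snoc {n : ℕ} (d : M.Hist n) (τ : Traj S A H) (θ : M.Θ) :
    M.likelihood (Fin.snoc d τ : M.Hist (n + 1)) θ =
      M.likelihood d θ * ∏ h, layerDens h τ (M.env θ h) := by
  simp only [likelihood, layerLikelihood, ← Finset.prod_mul_distrib]
  refine Finset.prod_congr rfl fun h _ => ?_
  rw [Fin.prod_univ_castSucc]
  simp only [Fin.snoc_castSucc, Fin.snoc_last]
  rfl

variable {M} {Q : ∀ n, Kernel (M.Hist n) M.Θ}

theorem measurable_trajLaw_opt :
    Measurable fun z : M.Θ × M.Θ => trajLaw (M.env z.1) (M.opt z.2) M.s₁ :=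
  (measurable_trajLaw (M.measurableEnvFamily_env.comp measurable_fst)
    (M.measurablePolicyFamily_opt.comp measurable_snd)).comp
      (f := fun z : M.Θ × M.Θ => (z, M.s₁)) (by fun_prop)

theorem measurable_episode (n : ℕ) :
    Measurable fun w : (M.Hist n × M.Θ) × M.Θ =>
      (trajLaw (M.env w.1.2) (M.opt w.2) M.s₁).map
        fun τ => ((Fin.snoc w.1.1 τ : M.Hist (n + 1)), w.1.2) :=
  measurable_map_param (κ := fun w : (M.Hist n × M.Θ) × M.Θ =>
      trajLaw (M.env w.1.2) (M.opt w.2) M.s₁)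
    (measurable_trajLaw_opt.comp (f := fun w : (M.Hist n × M.Θ) × M.Θ => (w.1.2, w.2))
      (by fun_prop))
    (f := fun w τ => ((Fin.snoc w.1.1 τ : M.Hist (n + 1)), w.1.2))
    ((measurable_finSnoc.comp (f := fun w : ((M.Hist n × M.Θ) × M.Θ) × Traj S A H =>
      (w.1.1.1, w.2)) (by fun_prop)).prodMk (by fun_prop))

theorem measurable_episode_bind (hQ : ∀ n, IsMarkovKernel (Q n)) (n : ℕ) :
    Measurable fun z : M.Hist n × M.Θ => (Q n z.1).bind fun θ' =>
      (trajLaw (M.env z.2) (M.opt θ') M.s₁).map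
        fun τ => ((Fin.snoc z.1 τ : M.Hist (n + 1)), z.2) := by
  have := hQ n
  exact measurable_bind_param (κ := fun z : M.Hist n × M.Θ => Q n z.1)
    ((Q n).measurable.comp measurable_fst)
    (η := fun z θ' => (trajLaw (M.env z.2) (M.opt θ') M.s₁).map
        fun τ => ((Fin.snoc z.1 τ : M.Hist (n + 1)), z.2)) (measurable_episode n)

theorem lintegral_jointLaw_succ (hQ : ∀ n, IsMarkovKernel (Q n)) (n : ℕ)
    {f : M.Hist (n + 1) × M.Θ → ℝ≥0∞} (hf : Measurable f) :
    ∫⁻ z, f z ∂(M.jointLaw Q (n + 1)) =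
      ∫⁻ z, ∫⁻ θ', ∫⁻ τ, f (Fin.snoc z.1 τ, z.2) ∂(trajLaw (M.env z.2) (M.opt θ') M.s₁)
        ∂(Q n z.1) ∂(M.jointLaw Q n) := by
  rw [jointLaw, Measure.lintegral_bind (measurable_episode_bind hQ n).aemeasurable hf.aemeasurable]
  refine lintegral_congr fun z => ?_
  refine (Measure.lintegral_bind ?_ hf.aemeasurable).trans ?_
  · have := (measurable_episode (M := M) n).comp (measurable_prodMk_left (x := z))
    simp only [Function.comp_def] at this
    exact this.aemeasurable
  refine lintegral_congr fun θ' => ?_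
  exact lintegral_map hf ((measurable_finSnoc.comp measurable_prodMk_left).prodMk measurable_const)

theorem isProbabilityMeasure_jointLaw (hQ : ∀ n, IsMarkovKernel (Q n)) (n : ℕ) :
    IsProbabilityMeasure (M.jointLaw Q n) := by
  induction n with
  | zero =>
    exact Measure.isProbabilityMeasure_map (by fun_prop)
  | succ n ih =>
    have := hQ n
    have h := lintegral_jointLaw_succ hQ n (f := fun _ => 1) measurable_const
    refine ⟨?_⟩
    simpa using h

/-- The policy of each episode is chosen from the history and a fresh sample, never from the true
environment. Its density, averaged over the sample, is thus a function of the history alone and is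
absorbed in `c`; the true environment enters only through the likelihood. -/
theorem exists_jointLaw_eq_withDensity (hQ : ∀ n, IsMarkovKernel (Q n)) (n : ℕ) :
    ∃ (ν : Measure (M.Hist n)) (c : M.Hist n → ℝ≥0∞), IsProbabilityMeasure ν ∧ Measurable c ∧
      M.jointLaw Q n = (ν.prod M.prior).withDensity fun z => c z.1 * M.likelihood z.1 z.2 := by
  induction n with
  | zero =>
    refine ⟨Measure.dirac Fin.elim0, 1, inferInstance, measurable_one, ?_⟩
    have h : (fun z : M.Hist 0 × M.Θ => (1 : M.Hist 0 → ℝ≥0∞) z.1 * M.likelihood z.1 z.2) = 1 := by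
      funext z
      simp [likelihood, layerLikelihood]
    rw [h, withDensity_one, Measure.dirac_prod]
    rfl
  | succ n ih =>
    obtain ⟨ν, c, hν, hc, hjoint⟩ := ih
    have := hQ n
    let β : Measure (Traj S A H) := trajBase M.μS M.μA H M.s₁
    -- The action density of the new episode, averaged over the environment sampled by the agent.
    let w : M.Hist n → Traj S A H → ℝ≥0∞ := fun d τ => ∫⁻ θ', policyDens (M.opt θ') τ ∂(Q n d)
    have hw : Measurable fun z : M.Hist n × Traj S A H => w z.1 z.2 :=
      measurable_lintegral_param (κ := fun z : M.Hist n × Traj S A H => Q n z.1)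
        ((Q n).measurable.comp measurable_fst) (f := fun z θ' => policyDens (M.opt θ') z.2)
        (M.measurablePolicyFamily_opt.measurable_policyDens.comp
          (f := fun u : (M.Hist n × Traj S A H) × M.Θ => (u.2, u.1.2)) (by fun_prop))
    have hinit : Measurable fun d : M.Hist (n + 1) => (Fin.init d : M.Hist n) :=
      measurable_pi_iff.2 fun i => measurable_pi_apply _
    let c' : M.Hist (n + 1) → ℝ≥0∞ := fun d => c (Fin.init d) * w (Fin.init d) (d (Fin.last n))
    have hc' : Measurable c' := (hc.comp hinit).mul
      (hw.comp (f := fun d : M.Hist (n + 1) => (Fin.init d, d (Fin.last n))) (by fun_prop))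
    let ν' : Measure (M.Hist (n + 1)) :=
      (ν.prod β).map fun z : M.Hist n × Traj S A H => (Fin.snoc z.1 z.2 : M.Hist (n + 1))
    have hν' : IsProbabilityMeasure ν' :=
      Measure.isProbabilityMeasure_map measurable_finSnoc.aemeasurable
    refine ⟨ν', c', hν', hc', Measure.ext_of_lintegral _ fun f hf => ?_⟩
    have hlik := M.measurable_likelihood (n := n)
    have hlik' := M.measurable_likelihood (n := n + 1)
    have hp : Measurable fun z : M.Hist n × M.Θ => c z.1 * M.likelihood z.1 z.2 :=
      (hc.comp measurable_fst).mul hlik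
    have hp' : Measurable fun z : M.Hist (n + 1) × M.Θ => c' z.1 * M.likelihood z.1 z.2 :=
      (hc'.comp measurable_fst).mul hlik'
    have hlay := M.measurableEnvFamily_env.measurable_prod_layerDens
    have hpol := M.measurablePolicyFamily_opt.measurable_policyDens
    have hfs : Measurable fun u : (M.Hist n × M.Θ) × Traj S A H =>
        f (Fin.snoc u.1.1 u.2, u.1.2) :=
      hf.comp ((measurable_finSnoc.comp (f := fun u : (M.Hist n × M.Θ) × Traj S A H =>
        (u.1.1, u.2)) (by fun_prop)).prodMk (by fun_prop))
    have hinner : ∀ z : M.Hist n × M.Θ, ∫⁻ θ', ∫⁻ τ, f (Fin.snoc z.1 τ, z.2)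
        ∂(trajLaw (M.env z.2) (M.opt θ') M.s₁) ∂(Q n z.1) =
        ∫⁻ τ, w z.1 τ * ((∏ h, layerDens h τ (M.env z.2 h)) * f (Fin.snoc z.1 τ, z.2)) ∂β := by
      intro z
      have hz : Measurable fun τ : Traj S A H => f (Fin.snoc z.1 τ, z.2) :=
        hfs.comp (measurable_prodMk_left (x := z))
      have hz' : Measurable fun τ : Traj S A H =>
          (∏ h, layerDens h τ (M.env z.2 h)) * f (Fin.snoc z.1 τ, z.2) :=
        (hlay.comp (measurable_prodMk_left (x := z.2))).mul hz
      simp_rw [lintegral_trajLaw_eq _ _ _ hz, mul_assoc]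
      -- By Tonelli the average over `θ'` reaches the policy density, the only factor that involves
      -- it.
      rw [lintegral_lintegral_swap]
      · refine lintegral_congr fun τ => ?_
        exact lintegral_mul_const _ (hpol.comp (f := fun θ' : M.Θ => (θ', τ)) (by fun_prop))
      · exact (hpol.mul (hz'.comp measurable_snd)).aemeasurable
    have hg : Measurable fun u : (M.Hist n × M.Θ) × Traj S A H =>
        w u.1.1 u.2 * ((∏ h, layerDens h u.2 (M.env u.1.2 h)) * f (Fin.snoc u.1.1 u.2, u.1.2)) :=
      (hw.comp (f := fun u : (M.Hist n × M.Θ) × Traj S A H => (u.1.1, u.2)) (by fun_prop)).mul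
        ((hlay.comp (f := fun u : (M.Hist n × M.Θ) × Traj S A H => (u.1.2, u.2))
          (by fun_prop)).mul hfs)
    have hg' : Measurable fun z : M.Hist n × M.Θ => ∫⁻ τ, w z.1 τ *
        ((∏ h, layerDens h τ (M.env z.2 h)) * f (Fin.snoc z.1 τ, z.2)) ∂β :=
      Measurable.lintegral_prod_right' hg
    have hq : Measurable fun z : M.Hist (n + 1) × M.Θ => c' z.1 * M.likelihood z.1 z.2 * f z :=
      hp'.mul hf
    rw [lintegral_jointLaw_succ hQ n hf, hjoint]
    simp_rw [hinner]
    rw [lintegral_withDensity_eq_lintegral_mul _ hp hg',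
      lintegral_withDensity_eq_lintegral_mul _ hp' hf]
    simp only [Pi.mul_apply]
    have hpg : Measurable fun z : M.Hist n × M.Θ => c z.1 * M.likelihood z.1 z.2 *
        ∫⁻ τ, w z.1 τ * ((∏ h, layerDens h τ (M.env z.2 h)) * f (Fin.snoc z.1 τ, z.2)) ∂β :=
      hp.mul hg'
    rw [lintegral_prod _ hpg.aemeasurable, lintegral_prod _ hq.aemeasurable,
      lintegral_map hq.lintegral_prod_right' measurable_finSnoc]
    have hs : Measurable fun z : M.Hist n × Traj S A H => ∫⁻ θ, c' (Fin.snoc z.1 z.2) *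
        M.likelihood (Fin.snoc z.1 z.2 : M.Hist (n + 1)) θ * f (Fin.snoc z.1 z.2, θ) ∂M.prior :=
      hq.lintegral_prod_right'.comp measurable_finSnoc
    refine Eq.trans ?_ (lintegral_prod _ hs.aemeasurable).symm
    refine lintegral_congr fun d => ?_
    have hgd : ∀ θ, Measurable fun τ : Traj S A H => w d τ *
        ((∏ h, layerDens h τ (M.env θ h)) * f (Fin.snoc d τ, θ)) := fun θ =>
      hg.comp (f := fun τ : Traj S A H => ((d, θ), τ)) (by fun_prop)
    simp_rw [← lintegral_const_mul _ (hgd _)]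
    rw [lintegral_lintegral_swap]
    · refine lintegral_congr fun τ => lintegral_congr fun θ => ?_
      rw [likelihood_snoc]
      simp only [c', Fin.init_snoc, Fin.snoc_last]
      ring
    · exact ((hp.comp (f := fun u : M.Θ × Traj S A H => (d, u.1)) (by fun_prop)).mul
        (hg.comp (f := fun u : M.Θ × Traj S A H => ((d, u.1), u.2)) (by fun_prop))).aemeasurable

end BayesianRL

/-! ### Two facts on product spaces: countable generation and product reweighting. -/

/-- Applied to `Θ`, this makes a disintegration over the history unique almost everywhere. -/
theorem MeasurableSpace.CountablyGenerated.pi {ι : Type*} [Countable ι] {X : ι → Type*}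
    [∀ i, MeasurableSpace (X i)] [h : ∀ i, MeasurableSpace.CountablyGenerated (X i)] :
    MeasurableSpace.CountablyGenerated (∀ i, X i) := by
  choose b hb hgen using fun i => (h i).isCountablyGenerated
  refine ⟨⋃ i, Set.preimage (fun x : ∀ i, X i => x i) '' b i,
    Set.countable_iUnion fun i => (hb i).image _, ?_⟩
  rw [← MeasurableSpace.iSup_generateFrom]
  refine iSup_congr fun i => ?_
  rw [← MeasurableSpace.comap_generateFrom, ← hgen i]

/-- Reweighting independent coordinates by a product of functions of single coordinates gives a
product measure. -/
theorem exists_eq_pi_of_iIndepFun {ι : Type*} [Fintype ι] {X : ι → Type*}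
    [∀ i, MeasurableSpace (X i)] {μ q : Measure (∀ i, X i)} [IsProbabilityMeasure q]
    (hμ : iIndepFun (fun i (x : ∀ i, X i) => x i) μ) {L : ∀ i, X i → ℝ≥0∞}
    (hL : ∀ i, Measurable (L i)) {C : ℝ≥0∞} (hC : C ≠ 0)
    (hq : q = C • μ.withDensity fun x => ∏ i, L i (x i)) :
    ∃ κ : ∀ i, Measure (X i), (∀ i, IsProbabilityMeasure (κ i)) ∧ q = Measure.pi κ := by
  classical
  have hprod : ∀ f : ∀ i, X i → ℝ≥0∞, (∀ i, Measurable (f i)) →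
      ∫⁻ x, ∏ i, f i (x i) ∂μ = ∏ i, ∫⁻ x, f i (x i) ∂μ := fun f hf =>
    lintegral_prod_eq_prod_lintegral_of_indepFun Finset.univ (fun i (x : ∀ i, X i) => f i (x i))
      (hμ.comp f hf) fun i => (hf i).comp (measurable_pi_apply i)
  set Z : ι → ℝ≥0∞ := fun i => ∫⁻ x, L i (x i) ∂μ with hZ
  -- Since `q` has mass one, the constants multiply to one. This excludes `0` and `∞` for every `Z
  -- i`, so each marginal can be normalised separately.
  have hZC : C * ∏ i, Z i = 1 := by
    rw [← hprod L hL, ← measure_univ (μ := q), hq, Measure.smul_apply, smul_eq_mul,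
      withDensity_apply _ .univ, Measure.restrict_univ]
  have hZ0 : ∀ i, Z i ≠ 0 := fun i hi => by
    rw [Finset.prod_eq_zero (Finset.mem_univ i) hi, mul_zero] at hZC
    exact zero_ne_one hZC
  have hZt : ∀ i, Z i ≠ ∞ := fun i hi => by
    rw [← Finset.mul_prod_erase _ _ (Finset.mem_univ i), hi,
      ENNReal.top_mul (Finset.prod_ne_zero_iff.2 fun j _ => hZ0 j), ENNReal.mul_top hC] at hZC
    exact ENNReal.top_ne_one hZC
  let κ : ∀ i, Measure (X i) := fun i =>
    (Z i)⁻¹ • (μ.map fun x => x i).withDensity (L i)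
  have hκs : ∀ i s, MeasurableSet s →
      κ i s = (Z i)⁻¹ * ∫⁻ x, s.indicator (L i) (x i) ∂μ := fun i s hs => by
    simp only [κ, Measure.smul_apply, smul_eq_mul]
    rw [withDensity_apply _ hs, ← lintegral_indicator hs,
      lintegral_map ((hL i).indicator hs) (measurable_pi_apply i)]
  have hκ : ∀ i, IsProbabilityMeasure (κ i) := fun i => ⟨by
    rw [hκs i _ .univ]
    simp only [Set.indicator_univ]
    exact ENNReal.inv_mul_cancel (hZ0 i) (hZt i)⟩
  refine ⟨κ, hκ, (Measure.pi_eq fun s hs => ?_).symm⟩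
  -- The indicator of a box is a product over coordinates, so independence also factors the integral
  -- over the box.
  have hind : ∀ x : ∀ i, X i, (Set.univ.pi s).indicator (fun x => ∏ i, L i (x i)) x =
      ∏ i, (s i).indicator (L i) (x i) := fun x => by
    by_cases hx : x ∈ Set.univ.pi s
    · rw [Set.indicator_of_mem hx]
      exact Finset.prod_congr rfl fun i _ => (Set.indicator_of_mem (hx i trivial) _).symm
    · rw [Set.indicator_of_notMem hx]
      obtain ⟨i, hi⟩ : ∃ i, x i ∉ s i := by simpa using hx
      exact (Finset.prod_eq_zero (Finset.mem_univ i) (Set.indicator_of_notMem hi _)).symm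
  have hs' : MeasurableSet (Set.univ.pi s) := MeasurableSet.univ_pi hs
  rw [hq, Measure.smul_apply, smul_eq_mul, withDensity_apply _ hs', ← lintegral_indicator hs']
  simp_rw [hind, hκs _ _ (hs _)]
  rw [hprod _ fun i => (hL i).indicator (hs i), Finset.prod_mul_distrib]
  have hCZ : C = ∏ i, (Z i)⁻¹ := by
    rw [← ENNReal.prod_inv_distrib (fun i _ j _ _ => Or.inl (hZ0 i))]
    exact ENNReal.eq_inv_of_mul_eq_one_left hZC
  rw [hCZ]

/-! ### Bayes' rule and independence of the layers under the posterior. -/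

namespace BayesianRL

variable {S A : Type*} [MeasurableSpace S] [MeasurableSpace A] {H : ℕ} {M : BayesianRL S A H}
  {Q : ∀ n, Kernel (M.Hist n) M.Θ}

theorem measurable_likelihood_right {n : ℕ} (d : M.Hist n) : Measurable (M.likelihood d) :=
  Finset.measurable_prod _ fun h _ => ((M.measurable_layerLikelihood h).comp
    (measurable_prodMk_left (x := d))).comp (measurable_pi_apply h)

/-- Bayes' rule: almost surely the posterior has a density with respect to the prior that is
proportional to the likelihood. -/
theorem IsPosterior.ae_eq_smul_withDensity (hQ : M.IsPosterior Q) (n : ℕ) :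
    ∀ᵐ d ∂(M.histLaw Q n), ∃ C : ℝ≥0∞, C ≠ 0 ∧ C ≠ ∞ ∧
      Q n d = C • M.prior.withDensity (M.likelihood d) := by
  have hmk := fun n => (hQ n).1
  have := hmk n
  have := isProbabilityMeasure_jointLaw hmk n
  have hhist : IsProbabilityMeasure (M.histLaw Q n) := by unfold histLaw; infer_instance
  have hcg : MeasurableSpace.CountablyGenerated M.Θ := .pi
  obtain ⟨ν, c, hν, hc, hjoint⟩ := exists_jointLaw_eq_withDensity hmk n
  set p : M.Hist n → M.Θ → ℝ≥0∞ := fun d θ => c d * M.likelihood d θ with hpdef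
  have hp : Measurable fun z : M.Hist n × M.Θ => p z.1 z.2 :=
    (hc.comp measurable_fst).mul M.measurable_likelihood
  have hpd : ∀ d, Measurable (p d) := fun d => hp.comp (measurable_prodMk_left (x := d))
  -- The marginal density of the history, by which Bayes' formula divides.
  set b : M.Hist n → ℝ≥0∞ := fun d => ∫⁻ θ, p d θ ∂M.prior with hbdef
  have hb : Measurable b := hp.lintegral_prod_right'
  have hhist_eq : M.histLaw Q n = ν.withDensity b := by
    refine Measure.ext fun s hs => ?_
    rw [histLaw, hjoint, Measure.fst_apply hs, withDensity_apply _ (measurable_fst hs),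
      withDensity_apply _ hs, ← Set.prod_univ, ← Measure.prod_restrict, Measure.restrict_univ,
      lintegral_prod _ hp.aemeasurable]
  have hbfin : ∀ᵐ d ∂ν, b d < ∞ := by
    refine ae_lt_top hb ?_
    have h : M.histLaw Q n Set.univ = 1 := measure_univ
    rw [hhist_eq, withDensity_apply _ .univ, Measure.restrict_univ] at h
    rw [h]
    exact ENNReal.one_ne_top
  -- The posterior given by Bayes' formula. It has mass at most one even where `b d` is `0` or `∞`,
  -- and it disintegrates the same joint law as `Q n`, so the two agree almost everywhere.
  let R : Kernel (M.Hist n) M.Θ := ⟨fun d => M.prior.withDensity fun θ => (b d)⁻¹ * p d θ,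
    measurable_withDensity_param (f := fun d θ => (b d)⁻¹ * p d θ)
      ((hb.inv.comp measurable_fst).mul hp)⟩
  have hR : ∀ d, R d = M.prior.withDensity fun θ => (b d)⁻¹ * p d θ := fun d => rfl
  have hRfin : IsFiniteKernel R := ⟨1, ENNReal.one_lt_top, fun d => by
    rw [hR, withDensity_apply _ .univ, Measure.restrict_univ, lintegral_const_mul _ (hpd d)]
    exact ENNReal.inv_mul_le_one _⟩
  have hcomp : (M.histLaw Q n).compProd (Q n) = (M.histLaw Q n).compProd R := by
    rw [← (hQ n).2]
    refine Measure.ext_of_lintegral _ fun f hf => ?_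
    rw [Measure.lintegral_compProd hf, hjoint, hhist_eq,
      lintegral_withDensity_eq_lintegral_mul _ hp hf,
      lintegral_withDensity_eq_lintegral_mul _ hb (Measurable.lintegral_kernel_prod_right' hf),
      lintegral_prod _ (hp.mul hf).aemeasurable]
    refine lintegral_congr_ae ?_
    filter_upwards [hbfin] with d hd
    have hfd : Measurable fun θ => f (d, θ) := hf.comp measurable_prodMk_left
    simp only [Pi.mul_apply]
    rw [hR, lintegral_withDensity_eq_lintegral_mul _ ((hpd d).const_mul _) hfd]
    simp only [Pi.mul_apply, mul_assoc]
    have hpf : Measurable fun θ => p d θ * f (d, θ) := (hpd d).mul hfd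
    rw [lintegral_const_mul _ hpf, ← mul_assoc]
    by_cases h0 : b d = 0
    · rw [h0, zero_mul, zero_mul]
      have h1 : p d =ᵐ[M.prior] 0 := (lintegral_eq_zero_iff (hpd d)).1 h0
      refine (lintegral_congr_ae ?_).trans lintegral_zero
      filter_upwards [h1] with θ hθ
      rw [hθ, Pi.zero_apply, zero_mul]
    · rw [ENNReal.mul_inv_cancel h0 hd.ne, one_mul]
  have hae := Kernel.ae_eq_of_compProd_eq hcomp
  have hb0 : ∀ᵐ d ∂(M.histLaw Q n), b d ≠ 0 := by
    rw [hhist_eq, ae_withDensity_iff hb]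
    exact ae_of_all _ fun _ h => h
  have hbfin' : ∀ᵐ d ∂(M.histLaw Q n), b d < ∞ := by
    rw [hhist_eq]
    exact (withDensity_absolutelyContinuous _ _).ae_le hbfin
  filter_upwards [hae, hb0, hbfin'] with d h1 h2 h3
  have hbd : b d = c d * ∫⁻ θ, M.likelihood d θ ∂M.prior :=
    lintegral_const_mul _ (measurable_likelihood_right d)
  -- A nonzero finite `b d` forces `c d` to be nonzero and finite.
  have hc0 : c d ≠ 0 := fun h => h2 (by rw [hbd, h, zero_mul])
  have hct : c d ≠ ∞ := fun h => by
    rw [hbd] at h2 h3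
    exact h3.ne (by rw [h, ENNReal.top_mul (right_ne_zero_of_mul h2)])
  refine ⟨(b d)⁻¹ * c d, mul_ne_zero (ENNReal.inv_ne_zero.2 h3.ne) hc0,
    ENNReal.mul_ne_top (ENNReal.inv_ne_top.2 h2) hct, ?_⟩
  rw [h1, hR, ← withDensity_smul _ (measurable_likelihood_right d)]
  congr 1
  funext θ
  simp only [hpdef, Pi.smul_apply, smul_eq_mul, mul_assoc]

/-- Under the posterior, conditioned on a cell of a layered partition, the layers are
independent. -/
theorem exists_cond_eq_pi {n : ℕ} {d : M.Hist n} {K : ℕ} {ζ : M.Θ → Fin K} (hζ : Measurable ζ)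
    (hlay : M.IsLayered ζ) {q : Measure M.Θ} [IsProbabilityMeasure q] {C : ℝ≥0∞} (hC : C ≠ 0)
    (hq : q = C • M.prior.withDensity (M.likelihood d)) (k : Fin K) (hk : q (ζ ⁻¹' {k}) ≠ 0) :
    ∃ κ : ∀ h, Measure (M.ΘP h × M.ΘR h), (∀ h, IsProbabilityMeasure (κ h)) ∧
      q[|ζ ⁻¹' {k}] = Measure.pi κ := by
  have hm : MeasurableSet (ζ ⁻¹' {k}) := hζ (measurableSet_singleton k)
  have hprior : M.prior (ζ ⁻¹' {k}) ≠ 0 := fun h => hk (by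
    rw [hq, Measure.smul_apply, smul_eq_mul, withDensity_absolutelyContinuous _ _ h, mul_zero])
  -- Restriction to the cell commutes with reweighting by the likelihood; the constant collects the
  -- two normalisations and `C`.
  have hcond : q[|ζ ⁻¹' {k}] = ((q (ζ ⁻¹' {k}))⁻¹ * C * M.prior (ζ ⁻¹' {k})) •
      (M.prior[|ζ ⁻¹' {k}]).withDensity (M.likelihood d) := by
    have h1 : q.restrict (ζ ⁻¹' {k}) =
        C • (M.prior.restrict (ζ ⁻¹' {k})).withDensity (M.likelihood d) := by
      rw [hq, Measure.restrict_smul, restrict_withDensity hm]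
    have h2 : M.prior.restrict (ζ ⁻¹' {k}) =
        M.prior (ζ ⁻¹' {k}) • M.prior[|ζ ⁻¹' {k}] := by
      rw [ProbabilityTheory.cond, smul_smul, ENNReal.mul_inv_cancel hprior (measure_ne_top _ _),
        one_smul]
    rw [ProbabilityTheory.cond, h1, h2, withDensity_smul_measure, smul_smul, smul_smul, mul_assoc]
  have := cond_isProbabilityMeasure hk
  refine exists_eq_pi_of_iIndepFun (hlay k hprior) (L := fun h => M.layerLikelihood h d)
    (fun h => (M.measurable_layerLikelihood h).comp (measurable_prodMk_left (x := d))) ?_ hcond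
  exact mul_ne_zero (mul_ne_zero (ENNReal.inv_ne_zero.2 (measure_ne_top _ _)) hC) hprior

end BayesianRL

/-! ### The return of the mean environment. -/

theorem lintegral_pi_succ_mul {m : ℕ} {X : Fin (m + 1) → Type*} [∀ i, MeasurableSpace (X i)]
    (κ : ∀ i, Measure (X i)) [∀ i, IsProbabilityMeasure (κ i)] {f : X 0 → ℝ≥0∞}
    (hf : Measurable f) {g : (∀ j : Fin m, X j.succ) → ℝ≥0∞} (hg : Measurable g) :
    ∫⁻ x, f (x 0) * g (fun j => x j.succ) ∂(Measure.pi κ) =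
      (∫⁻ x, f x ∂(κ 0)) * ∫⁻ y, g y ∂(Measure.pi fun j : Fin m => κ j.succ) := by
  have h := (measurePreserving_piFinSuccAbove κ 0).lintegral_comp
    (f := fun z : X 0 × (∀ j : Fin m, X j.succ) => f z.1 * g z.2)
    ((hf.comp measurable_fst).mul (hg.comp measurable_snd))
  exact h.trans (lintegral_prod_mul hf.aemeasurable hg.aemeasurable)

section MeanReturn

variable {S A : Type*} [MeasurableSpace S] [MeasurableSpace A] {μS : Measure S} {μA : Measure A}

/-- If the layers of a random environment are independent, the mean of its return is the return of
the mean environment. -/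
theorem lintegral_lreturn_pi [SFinite μS] [SFinite μA] {m : ℕ} {X : Fin m → Type*}
    [∀ h, MeasurableSpace (X h)] (κ : ∀ h, Measure (X h)) [∀ h, IsProbabilityMeasure (κ h)]
    (e : ∀ h, X h → TransitionFn A μS × RewardFn S A)
    (hP : ∀ h, Measurable fun z : X h × S × A × S => (e h z.1).1.dens z.2.1 z.2.2.1 z.2.2.2)
    (hR : ∀ h, Measurable fun z : X h × S × A × ℝ => (e h z.1).2.dens z.2.1 z.2.2.1 z.2.2.2)
    (E : Env A μS m)
    (hEP : ∀ h s a s', (E h).1.dens s a s' = ∫⁻ x, (e h x).1.dens s a s' ∂(κ h))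
    (hER : ∀ h s a y, (E h).2.dens s a y = ∫⁻ x, (e h x).2.dens s a y ∂(κ h))
    (π : Policy S μA m) (s : S) :
    ∫⁻ x, lreturn (fun h => e h (x h)) π s ∂(Measure.pi κ) = lreturn E π s := by
  induction m generalizing s with
  | zero => simp [lreturn]
  | succ m ih =>
    have hE : MeasurableEnvFamily fun x : ∀ h, X h => fun h => e h (x h) := fun h =>
      ⟨(hP h).comp (f := fun z : (∀ h, X h) × S × A × S => (z.1 h, z.2)) (by fun_prop),
        (hR h).comp (f := fun z : (∀ h, X h) × S × A × ℝ => (z.1 h, z.2)) (by fun_prop)⟩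
    have hE' : MeasurableEnvFamily fun x : ∀ h : Fin m, X h.succ => fun h => e h.succ (x h) :=
      fun h => ⟨(hP h.succ).comp (f := fun z : (∀ h : Fin m, X h.succ) × S × A × S =>
          (z.1 h, z.2)) (by fun_prop),
        (hR h.succ).comp (f := fun z : (∀ h : Fin m, X h.succ) × S × A × ℝ =>
          (z.1 h, z.2)) (by fun_prop)⟩
    have htail : Measurable fun w : (∀ h, X h) × S =>
        lreturn (fun j : Fin m => e j.succ (w.1 j.succ)) (fun j : Fin m => π j.succ) w.2 :=
      measurable_lreturn hE.tail (measurablePolicyFamily_const fun j : Fin m => π j.succ)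
    have htail' : Measurable fun w : (∀ h : Fin m, X h.succ) × S =>
        lreturn (fun j : Fin m => e j.succ (w.1 j)) (fun j : Fin m => π j.succ) w.2 :=
      measurable_lreturn hE' (measurablePolicyFamily_const fun j : Fin m => π j.succ)
    have hlm : Measurable fun w : (∀ h, X h) × A => (e 0 (w.1 0)).2.lmean s w.2 :=
      (hE.measurable_lmean 0).comp (f := fun w : (∀ h, X h) × A => (w.1, s, w.2)) (by fun_prop)
    have hint : Measurable fun w : ((∀ h, X h) × A) × S => (e 0 (w.1.1 0)).1.dens s w.1.2 w.2 *
        lreturn (fun j : Fin m => e j.succ (w.1.1 j.succ)) (fun j : Fin m => π j.succ) w.2 :=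
      ((hE 0).1.comp (f := fun w : ((∀ h, X h) × A) × S => (w.1.1, s, w.1.2, w.2))
        (by fun_prop)).mul (htail.comp (f := fun w : ((∀ h, X h) × A) × S => (w.1.1, w.2))
        (by fun_prop))
    have hint' : Measurable fun w : (∀ h, X h) × A => ∫⁻ s', (e 0 (w.1 0)).1.dens s w.2 s' *
        lreturn (fun j : Fin m => e j.succ (w.1 j.succ)) (fun j : Fin m => π j.succ) s' ∂μS :=
      Measurable.lintegral_prod_right' hint
    have hπ : Measurable fun w : (∀ h, X h) × A => (π 0).dens s w.2 :=
      ((π 0).measurable_dens_right s).comp measurable_snd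
    simp only [lreturn]
    rw [lintegral_lintegral_swap (hπ.mul (hlm.add hint')).aemeasurable]
    refine lintegral_congr fun a => ?_
    have hlm_a : Measurable fun x : ∀ h, X h => (e 0 (x 0)).2.lmean s a :=
      hlm.comp measurable_prodMk_right
    have hint_a := hint'.comp (measurable_prodMk_right (y := a))
    have hsum : Measurable fun x : ∀ h, X h => (e 0 (x 0)).2.lmean s a +
        ∫⁻ s', (e 0 (x 0)).1.dens s a s' * lreturn (fun j : Fin m => e j.succ (x j.succ))
          (fun j : Fin m => π j.succ) s' ∂μS := hlm_a.add hint_a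
    rw [lintegral_const_mul _ hsum, lintegral_add_left hlm_a]
    -- The reward term involves layer `0` only. In the transition term the density involves layer
    -- `0` and the continuation only later layers, so by independence the mean of their product is
    -- the product of their means.
    congr 2
    · have hR0 : Measurable fun w : X 0 × ℝ => (e 0 w.1).2.dens s a w.2 * ENNReal.ofReal w.2 :=
        ((hR 0).comp (f := fun w : X 0 × ℝ => (w.1, s, a, w.2)) (by fun_prop)).mul (by fun_prop)
      have hl0 : Measurable fun x : X 0 => (e 0 x).2.lmean s a :=
        Measurable.lintegral_prod_right' hR0
      have h := lintegral_pi_succ_mul κ hl0 (g := fun _ => 1) measurable_const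
      simp only [mul_one, lintegral_const, measure_univ] at h
      rw [h]
      unfold RewardFn.lmean
      rw [lintegral_lintegral_swap hR0.aemeasurable]
      refine lintegral_congr fun y => ?_
      rw [hER]
      exact lintegral_mul_const _ ((hR 0).comp (f := fun x : X 0 => (x, s, a, y)) (by fun_prop))
    · rw [lintegral_lintegral_swap]
      · refine lintegral_congr fun s' => ?_
        have h := lintegral_pi_succ_mul κ (f := fun x : X 0 => (e 0 x).1.dens s a s')
          ((hP 0).comp (f := fun x : X 0 => (x, s, a, s')) (by fun_prop))
          (g := fun y => lreturn (fun j : Fin m => e j.succ (y j)) (fun j : Fin m => π j.succ) s')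
          (htail'.comp measurable_prodMk_right)
        rw [h, hEP, ih (fun j => κ j.succ) (fun j => e j.succ) (fun j => hP j.succ)
          (fun j => hR j.succ) (fun j => E j.succ) (fun j => hEP j.succ) (fun j => hER j.succ)]
      · exact (hint.comp (f := fun w : (∀ h, X h) × S => ((w.1, a), w.2))
          (by fun_prop)).aemeasurable

end MeanReturn

namespace BayesianRL

variable {S A : Type*} [MeasurableSpace S] [MeasurableSpace A] {H : ℕ} (M : BayesianRL S A H)

/-- The mean of the environments under a probability measure. -/
noncomputable def meanEnv (q : Measure M.Θ) [IsProbabilityMeasure q] : Env A M.μS H := fun h =>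
  (⟨fun s a s' => ∫⁻ θ, (M.env θ h).1.dens s a s' ∂q,
      Measurable.lintegral_prod_right' (f := fun w : (S × A × S) × M.Θ =>
        (M.env w.2 h).1.dens w.1.1 w.1.2.1 w.1.2.2) ((M.measurableEnvFamily_env h).1.comp
        (f := fun w : (S × A × S) × M.Θ => (w.2, w.1)) (by fun_prop)),
      fun s a => by
        rw [lintegral_lintegral_swap]
        · simp [(M.env _ h).1.lintegral_dens]
        · exact ((M.measurableEnvFamily_env h).1.comp
            (f := fun w : S × M.Θ => (w.2, s, a, w.1)) (by fun_prop)).aemeasurable⟩,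
    ⟨fun s a y => ∫⁻ θ, (M.env θ h).2.dens s a y ∂q,
      Measurable.lintegral_prod_right' (f := fun w : (S × A × ℝ) × M.Θ =>
        (M.env w.2 h).2.dens w.1.1 w.1.2.1 w.1.2.2) ((M.measurableEnvFamily_env h).2.comp
        (f := fun w : (S × A × ℝ) × M.Θ => (w.2, w.1)) (by fun_prop)),
      fun s a => by
        rw [lintegral_lintegral_swap]
        · simp [(M.env _ h).2.lintegral_dens]
        · exact ((M.measurableEnvFamily_env h).2.comp
            (f := fun w : ℝ × M.Θ => (w.2, s, a, w.1)) (by fun_prop)).aemeasurable⟩)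

theorem isMeanEnv_meanEnv (q : Measure M.Θ) [IsProbabilityMeasure q] :
    M.IsMeanEnv q (M.meanEnv q) := fun _ _ _ => ⟨fun _ => rfl, fun _ => rfl⟩

variable {M}

/-- The densities of layer `h` depend on coordinate `h` alone, so their means may be taken under the
marginal `κ h`. -/
theorem IsMeanEnv.lreturn_eq {κ : ∀ h, Measure (M.ΘP h × M.ΘR h)}
    [∀ h, IsProbabilityMeasure (κ h)] {E : Env A M.μS H} (hE : M.IsMeanEnv (Measure.pi κ) E)
    (π : Policy S M.μA H) (s : S) :
    lreturn E π s = ∫⁻ θ, lreturn (M.env θ) π s ∂(Measure.pi κ) := by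
  have hP : ∀ h, Measurable fun z : (M.ΘP h × M.ΘR h) × S × A × S =>
      z.1.1.1.dens z.2.1 z.2.2.1 z.2.2.2 := fun h => (M.measurable_evalP h).comp
        (f := fun z : (M.ΘP h × M.ΘR h) × S × A × S => (z.1.1, z.2)) (by fun_prop)
  have hR : ∀ h, Measurable fun z : (M.ΘP h × M.ΘR h) × S × A × ℝ =>
      z.1.2.1.dens z.2.1 z.2.2.1 z.2.2.2 := fun h => (M.measurable_evalR h).comp
        (f := fun z : (M.ΘP h × M.ΘR h) × S × A × ℝ => (z.1.2, z.2)) (by fun_prop)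
  refine (lintegral_lreturn_pi κ (fun h x => (x.1.1, x.2.1)) hP hR E (fun h s a s' => ?_)
    (fun h s a y => ?_) π s).symm
  · rw [(hE h s a).1 s']
    exact (measurePreserving_eval κ h).lintegral_comp
      ((hP h).comp (f := fun x : M.ΘP h × M.ΘR h => (x, s, a, s')) (by fun_prop))
  · rw [(hE h s a).2 y]
    exact (measurePreserving_eval κ h).lintegral_comp
      ((hR h).comp (f := fun x : M.ΘP h × M.ΘR h => (x, s, a, y)) (by fun_prop))

end BayesianRL

/-! ### Measurable selection from sections of positive measure. -/

/-- Countably many horizontal sections of a set suffice to cover, up to a null set, every point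
whose vertical section has positive measure. -/
theorem exists_seq_ae_mem_section {D T : Type*} [MeasurableSpace D] [MeasurableSpace T] [Nonempty T]
    (ν : Measure D) [IsFiniteMeasure ν] (ρ : Measure T) [SFinite ρ] {B : Set (D × T)}
    (hB : MeasurableSet B) :
    ∃ u : ℕ → T, ∀ᵐ d ∂ν, ρ (Prod.mk d ⁻¹' B) ≠ 0 → ∃ i, (d, u i) ∈ B := by
  let U : (ℕ → T) → Set D := fun u => ⋃ i, {d | (d, u i) ∈ B}
  have hBt : ∀ t, MeasurableSet {d | (d, t) ∈ B} := fun t => measurable_prodMk_right hB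
  have hU : ∀ u, MeasurableSet (U u) := fun u => MeasurableSet.iUnion fun i => hBt _
  -- Exhaustion: take sequences whose covered sets approach the supremal measure and interleave them
  -- all into `v`, which attains it.
  obtain ⟨a, -, ha, hmem⟩ := exists_seq_tendsto_sSup (Set.range_nonempty fun u => ν (U u))
    (OrderTop.bddAbove _)
  choose u hu using hmem
  let v : ℕ → T := fun m => u m.unpair.1 m.unpair.2
  have hsub : ∀ n, U (u n) ⊆ U v := fun n => Set.iUnion_subset fun i d hd =>
    Set.mem_iUnion.2 ⟨Nat.pair n i, by simpa [v] using hd⟩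
  have hv : ∀ w, ν (U w) ≤ ν (U v) := fun w => by
    refine (le_sSup (Set.mem_range_self w)).trans (le_of_tendsto' ha fun n => ?_)
    rw [← hu n]
    exact measure_mono (hsub n)
  -- Prepending `t` to `v` cannot increase the maximal measure, so `t` covers nothing new up to a
  -- null set.
  have hnull : ∀ t, ν ({d | (d, t) ∈ B} \ U v) = 0 := fun t => by
    let w : ℕ → T := fun i => Nat.casesOn i t v
    have hw : U v ∪ ({d | (d, t) ∈ B} \ U v) ⊆ U w := by
      rintro d (hd | hd)
      · obtain ⟨i, hi⟩ := Set.mem_iUnion.1 hd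
        exact Set.mem_iUnion.2 ⟨i + 1, hi⟩
      · exact Set.mem_iUnion.2 ⟨0, hd.1⟩
    have h := (measure_mono hw).trans (hv w)
    rw [measure_union Set.disjoint_sdiff_right ((hBt t).diff (hU v))] at h
    exact nonpos_iff_eq_zero.1 ((ENNReal.add_le_add_iff_left (measure_ne_top ν (U v))).1
      (by simpa using h))
  -- Every horizontal section of the uncovered part is null, so the part itself is null, and hence
  -- so are almost all of its vertical sections.
  have hC : (ν.prod ρ) (B \ (U v ×ˢ Set.univ)) = 0 := by
    rw [Measure.prod_apply_symm (hB.diff ((hU v).prod .univ))]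
    refine (lintegral_congr fun t => ?_).trans lintegral_zero
    have : (fun d => (d, t)) ⁻¹' (B \ (U v ×ˢ Set.univ)) = {d | (d, t) ∈ B} \ U v := by
      ext d; simp
    rw [this, hnull]
  refine ⟨v, ?_⟩
  filter_upwards [Measure.measure_ae_null_of_prod_null hC] with d hd hpos
  by_contra hno
  refine hpos (measure_mono_null (fun t ht => ?_) hd)
  exact ⟨ht, fun h => hno (by simpa [U] using h.1)⟩

/-- A measurable selection that is almost surely successful where the section of the set to select
from has positive measure. -/
theorem exists_measurable_selection {D T : Type*} [MeasurableSpace D] [MeasurableSpace T]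
    (ν : Measure D) [IsFiniteMeasure ν] (ρ : Measure T) [SFinite ρ] {B : Set (D × T)}
    (hB : MeasurableSet B) (t₀ : T) :
    ∃ f : D → T, Measurable f ∧ (∀ d, f d = t₀ ∨ (d, f d) ∈ B) ∧
      ∀ᵐ d ∂ν, ρ (Prod.mk d ⁻¹' B) ≠ 0 → (d, f d) ∈ B := by
  classical
  have : Nonempty T := ⟨t₀⟩
  obtain ⟨u, hu⟩ := exists_seq_ae_mem_section ν ρ hB
  -- Index `i + 1` stands for the point `u i`; index `0` is the fallback `t₀`, allowed only when no
  -- `u i` lies in the section, so taking the least index never prefers it to a successful point.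
  let p : ℕ → D → Prop
    | 0, d => ∀ i, (d, u i) ∉ B
    | i + 1, d => (d, u i) ∈ B
  let g : ℕ → T
    | 0 => t₀
    | i + 1 => u i
  have hBt : ∀ t, MeasurableSet {d | (d, t) ∈ B} := fun t => measurable_prodMk_right hB
  have hp : ∀ n, MeasurableSet {d | p n d} := fun n => by
    cases n with
    | zero =>
      have : {d | p 0 d} = ⋂ i, {d | (d, u i) ∈ B}ᶜ := by ext d; simp [p]
      rw [this]
      exact MeasurableSet.iInter fun i => (hBt _).compl
    | succ i => exact hBt (u i)
  have hex : ∀ d, ∃ n, p n d := fun d => by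
    by_cases h : ∃ i, (d, u i) ∈ B
    · exact ⟨h.choose + 1, h.choose_spec⟩
    · exact ⟨0, not_exists.1 h⟩
  have hspec : ∀ d n, p n d → n = 0 ∨ (d, g n) ∈ B := fun d n h => by
    cases n with
    | zero => exact Or.inl rfl
    | succ i => exact Or.inr h
  have hdec : ∀ n, DecidablePred (p n) := fun n => Classical.decPred _
  refine ⟨_, Measurable.find (p := p) (f := fun n _ => g n) (fun n => measurable_const) hp hex,
    fun d => ?_, ?_⟩
  · rcases hspec d _ (Nat.find_spec (p := fun n => p n d) (hex d)) with h | h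
    · exact Or.inl (by simp only [h, g])
    · exact Or.inr h
  · filter_upwards [hu] with d hd hpos
    rcases hspec d _ (Nat.find_spec (p := fun n => p n d) (hex d)) with h | h
    · have h0 : p _ d := Nat.find_spec (p := fun n => p n d) (hex d)
      rw [h] at h0
      obtain ⟨i, hi⟩ := hd hpos
      exact absurd hi (h0 i)
    · exact h

/-! ### Regret comparison and construction of the surrogates. -/

namespace BayesianRL

variable {S A : Type*} [MeasurableSpace S] [MeasurableSpace A] {H : ℕ} {M : BayesianRL S A H}

theorem measurableEnvFamily_of_countable {m : ℕ} {μS : Measure S} {ι : Type*} [Countable ι]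
    [MeasurableSpace ι] [MeasurableSingletonClass ι] (E : ι → Env A μS m) :
    MeasurableEnvFamily E := fun h =>
  ⟨measurable_from_prod_countable_right fun i => (E i h).1.measurable_dens,
    measurable_from_prod_countable_right fun i => (E i h).2.measurable_dens⟩

theorem measurable_lreturn_prod {X : Type*} [MeasurableSpace X] {E : X → Env A M.μS H}
    (hE : MeasurableEnvFamily E) :
    Measurable fun z : X × M.Θ => lreturn (E z.1) (M.opt z.2) M.s₁ :=
  (measurable_lreturn (hE.comp measurable_fst)
    (M.measurablePolicyFamily_opt.comp measurable_snd)).comp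
    (f := fun z : X × M.Θ => (z, M.s₁)) (by fun_prop)

theorem lintegral_eq_sum_cells {X : Type*} [MeasurableSpace X] {K : ℕ} {ζ : X → Fin K}
    (hζ : Measurable ζ) (q : Measure X) (f : X → ℝ≥0∞) :
    ∫⁻ x, f x ∂q = ∑ k, ∫⁻ x in ζ ⁻¹' {k}, f x ∂q := by
  have h : ⋃ k, ζ ⁻¹' {k} = Set.univ := by ext x; simp
  rw [← setLIntegral_univ f, ← h, lintegral_iUnion (fun k => hζ (measurableSet_singleton k)),
    tsum_fintype]
  intro i j hij
  exact Disjoint.preimage ζ (by simpa using hij)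

/-- The regret comparison, from a comparison of the optimal values in every cell and of the
mean values of the sampled policies in every cell. -/
theorem tsRegret_sub_surrogateRegret_le {q : Measure M.Θ} [IsProbabilityMeasure q] {K : ℕ}
    {ζ : M.Θ → Fin K} (hζ : Measurable ζ) (E : Fin K → Env A M.μS H) {ε : ℝ}
    (hopt : ∀ᵐ θ ∂q, M.V (M.env θ) (M.opt θ) - M.V (E (ζ θ)) (M.opt θ) ≤ ε)
    (hsample : ∀ k, ∫⁻ _ in ζ ⁻¹' {k}, ∫⁻ θ', lreturn (E k) (M.opt θ') M.s₁ ∂q ∂q ≤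
      ∫⁻ θ in ζ ⁻¹' {k}, ∫⁻ θ', lreturn (M.env θ) (M.opt θ') M.s₁ ∂q ∂q) :
    M.tsRegret q - M.surrogateRegret q ζ E ≤ ε := by
  have hEζ : MeasurableEnvFamily fun θ => E (ζ θ) := (measurableEnvFamily_of_countable E).comp hζ
  have hb := measurable_lreturn_prod (M := M) M.measurableEnvFamily_env
  have hb' := measurable_lreturn_prod (M := M) hEζ
  have ha : Measurable fun z : M.Θ × M.Θ => lreturn (M.env z.1) (M.opt z.1) M.s₁ :=
    hb.comp (f := fun z : M.Θ × M.Θ => (z.1, z.1)) (by fun_prop)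
  have ha' : Measurable fun z : M.Θ × M.Θ => lreturn (E (ζ z.1)) (M.opt z.1) M.s₁ :=
    hb'.comp (f := fun z : M.Θ × M.Θ => (z.1, z.1)) (by fun_prop)
  have hint : ∀ {f : M.Θ × M.Θ → ℝ≥0∞}, Measurable f → (∀ z, f z ≤ H) →
      Integrable (fun z => (f z).toReal) (q.prod q) := fun hf hle => by
    refine integrable_toReal_of_lintegral_ne_top hf.aemeasurable (ne_top_of_le_ne_top ?_
      (lintegral_mono hle))
    simp
  have ia := hint ha fun z => lreturn_le _ _ _
  have ia' := hint ha' fun z => lreturn_le _ _ _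
  have ib := hint hb fun z => lreturn_le _ _ _
  have ib' := hint hb' fun z => lreturn_le _ _ _
  have hfin : ∫⁻ z : M.Θ × M.Θ, lreturn (M.env z.1) (M.opt z.2) M.s₁ ∂(q.prod q) ≠ ∞ := by
    refine ne_top_of_le_ne_top ?_ (lintegral_mono fun z => lreturn_le _ _ _)
    simp
  -- The sampled policies do no better in the surrogate on average: this is `hsample` summed over
  -- the cells.
  have hle : ∫ z : M.Θ × M.Θ, (lreturn (E (ζ z.1)) (M.opt z.2) M.s₁).toReal ∂(q.prod q) ≤
      ∫ z : M.Θ × M.Θ, (lreturn (M.env z.1) (M.opt z.2) M.s₁).toReal ∂(q.prod q) := by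
    rw [integral_toReal hb'.aemeasurable
        (ae_of_all _ fun z => (lreturn_ne_top _ _ _).lt_top),
      integral_toReal hb.aemeasurable (ae_of_all _ fun z => (lreturn_ne_top _ _ _).lt_top)]
    refine ENNReal.toReal_mono hfin ?_
    rw [lintegral_prod _ hb'.aemeasurable, lintegral_prod _ hb.aemeasurable,
      lintegral_eq_sum_cells hζ, lintegral_eq_sum_cells hζ q]
    refine Finset.sum_le_sum fun k _ => le_trans (le_of_eq ?_) (hsample k)
    refine setLIntegral_congr_fun (hζ (measurableSet_singleton k)) fun θ hθ => ?_
    have hθ' : ζ θ = k := hθ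
    simp only [hθ']
  have hdiff : ∫ z : M.Θ × M.Θ, ((lreturn (M.env z.1) (M.opt z.1) M.s₁).toReal -
      (lreturn (E (ζ z.1)) (M.opt z.1) M.s₁).toReal) ∂(q.prod q) ≤ ε := by
    have h := Measure.quasiMeasurePreserving_fst (μ := q) (ν := q) |>.ae hopt
    refine (integral_mono_ae (ia.sub ia') (integrable_const ε) ?_).trans (by simp)
    filter_upwards [h] with z hz
    simpa only [V_eq, Pi.sub_apply] using hz
  rw [integral_sub ia ia'] at hdiff
  rw [tsRegret, surrogateRegret]
  simp only [V_eq]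
  rw [integral_sub ia ib, integral_sub ia' ib']
  linarith

variable {Q : ∀ n, Kernel (M.Hist n) M.Θ}

/-- Surrogate environments in `Θ`, for every partition. -/
theorem exists_surrogate_mem (hQ : M.IsPosterior Q) {ε : ℝ} {K : ℕ} {ζ : M.Θ → Fin K}
    (hζ : M.IsValuePartition ε ζ) (n : ℕ) :
    ∃ E : M.Hist n → Fin K → M.Θ,
      (∀ k, Measurable fun d => E d k) ∧
      (∀ d θ, ζ (E d (ζ θ)) = ζ θ) ∧
      ∀ᵐ d ∂(M.histLaw Q n),
        M.tsRegret (Q n d) - M.surrogateRegret (Q n d) ζ (fun k => M.env (E d k)) ≤ ε := by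
  have := (hQ n).1
  have := isProbabilityMeasure_jointLaw (fun n => (hQ n).1) n
  have hhist : IsProbabilityMeasure (M.histLaw Q n) := by unfold histLaw; infer_instance
  have hm : ∀ k, MeasurableSet (ζ ⁻¹' {k}) := fun k => hζ.1 (measurableSet_singleton k)
  have hv := measurable_lreturn_prod (M := M) M.measurableEnvFamily_env
  let g : M.Hist n → M.Θ → ℝ≥0∞ := fun d θ => ∫⁻ θ', lreturn (M.env θ) (M.opt θ') M.s₁ ∂(Q n d)
  have hg : Measurable fun z : M.Hist n × M.Θ => g z.1 z.2 :=
    measurable_lintegral_param (κ := fun z : M.Hist n × M.Θ => Q n z.1)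
      ((Q n).measurable.comp measurable_fst)
      (f := fun z θ' => lreturn (M.env z.2) (M.opt θ') M.s₁)
      (hv.comp (f := fun w : (M.Hist n × M.Θ) × M.Θ => (w.1.2, w.2)) (by fun_prop))
  -- Points of the cell where `g` is at most its posterior cell average; multiplying by the mass of
  -- the cell avoids division by zero.
  let B : Fin K → Set (M.Hist n × M.Θ) := fun k =>
    {z | ζ z.2 = k ∧ g z.1 z.2 * Q n z.1 (ζ ⁻¹' {k}) ≤ ∫⁻ θ in ζ ⁻¹' {k}, g z.1 θ ∂(Q n z.1)}
  have hB : ∀ k, MeasurableSet (B k) := fun k => by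
    have hQk : Measurable fun d => Q n d (ζ ⁻¹' {k}) := (Q n).measurable_coe (hm k)
    have hGk : Measurable fun d => ∫⁻ θ in ζ ⁻¹' {k}, g d θ ∂(Q n d) := by
      simp_rw [← lintegral_indicator (hm k)]
      exact measurable_lintegral_param (Q n).measurable
        (f := fun d θ => (ζ ⁻¹' {k}).indicator (g d) θ) (hg.indicator (measurable_snd (hm k)))
    exact (measurable_snd (hm k)).inter (measurableSet_le
      (hg.mul (hQk.comp measurable_fst)) (hGk.comp measurable_fst))
  have hne : Nonempty M.Θ := M.prior.nonempty_of_neZero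
  -- Fallback points lying in their own nonempty cells, so that cell membership holds for every
  -- history, even where the selection fails.
  have hrep : ∃ t : Fin K → M.Θ, ∀ θ, ζ (t (ζ θ)) = ζ θ := by
    classical
    refine ⟨fun k => if h : ∃ θ, ζ θ = k then h.choose else hne.some, fun θ => ?_⟩
    have h : ∃ θ', ζ θ' = ζ θ := ⟨θ, rfl⟩
    simp only [dif_pos h]
    exact h.choose_spec
  obtain ⟨t, ht⟩ := hrep
  choose f hf hfB hfae using fun k =>
    exists_measurable_selection (M.histLaw Q n) M.prior (hB k) (t k)
  have hcell : ∀ d θ, ζ (f (ζ θ) d) = ζ θ := fun d θ => by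
    rcases hfB (ζ θ) d with h | h
    · rw [h, ht]
    · exact h.1
  refine ⟨fun d k => f k d, hf, hcell, ?_⟩
  filter_upwards [hQ.ae_eq_smul_withDensity n, ae_all_iff.2 hfae] with d ⟨C, _, _, hC⟩ hd
  have hac : Q n d ≪ M.prior := by
    rw [hC]
    exact (withDensity_absolutelyContinuous _ _).smul_left C
  refine tsRegret_sub_surrogateRegret_le hζ.1 _
    (ae_of_all _ fun θ => hζ.2 θ _ (hcell d θ).symm) fun k => ?_
  rw [lintegral_const, Measure.restrict_apply_univ]
  by_cases hk : Q n d (ζ ⁻¹' {k}) = 0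
  · rw [hk, mul_zero]
    exact zero_le
  · refine (hd k fun h0 => ?_).2
    -- A function is at most its average on a set of positive measure. By `hac` this set is not null
    -- for the prior either, so the selection succeeds.
    have hpos := measure_le_setLAverage_pos hk (measure_ne_top _ _)
      (hg.comp (measurable_prodMk_left (x := d))).aemeasurable
    refine hpos.ne' (measure_mono_null (fun θ hθ => ?_) (hac h0))
    refine ⟨hθ.1, ENNReal.mul_le_of_le_div ?_⟩
    have := hθ.2
    rwa [setLAverage_eq] at this

/-- The posterior means over the cells, for every layered partition. -/
theorem exists_surrogate_mean (hQ : M.IsPosterior Q) {ε : ℝ} {K : ℕ} {ζ : M.Θ → Fin K}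
    (hζ : M.IsValuePartition ε ζ) (hlay : M.IsLayered ζ) (n : ℕ) :
    ∃ E : M.Hist n → Fin K → Env A M.μS H,
      (∀ k, M.MeasurableEnv fun d => E d k) ∧
      (∀ d k, Q n d (ζ ⁻¹' {k}) ≠ 0 → M.IsMeanEnv ((Q n d)[|ζ ⁻¹' {k}]) (E d k)) ∧
      ∀ᵐ d ∂(M.histLaw Q n),
        M.tsRegret (Q n d) - M.surrogateRegret (Q n d) ζ (E d) ≤ ε := by
  classical
  have := (hQ n).1
  have hm : ∀ k, MeasurableSet (ζ ⁻¹' {k}) := fun k => hζ.1 (measurableSet_singleton k)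
  have hne : Nonempty M.Θ := M.prior.nonempty_of_neZero
  -- On cells without posterior mass, where no mean is required, an arbitrary fixed environment
  -- keeps the choice measurable.
  let E : M.Hist n → Fin K → Env A M.μS H := fun d k =>
    if h : Q n d (ζ ⁻¹' {k}) ≠ 0 then
      have := cond_isProbabilityMeasure h
      M.meanEnv ((Q n d)[|ζ ⁻¹' {k}])
    else M.env hne.some
  have hmean : ∀ d k, Q n d (ζ ⁻¹' {k}) ≠ 0 → M.IsMeanEnv ((Q n d)[|ζ ⁻¹' {k}]) (E d k) :=
    fun d k h => by
      have := cond_isProbabilityMeasure h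
      simp only [E, dif_pos h]
      exact M.isMeanEnv_meanEnv _
  refine ⟨E, fun k => ?_, hmean, ?_⟩
  · have hQk : Measurable fun d => Q n d (ζ ⁻¹' {k}) := (Q n).measurable_coe (hm k)
    have hcond : ∀ {Y : Type _} [MeasurableSpace Y] (F : M.Θ → Y → ℝ≥0∞),
        Measurable (fun z : M.Θ × Y => F z.1 z.2) → Measurable fun z : M.Hist n × Y =>
          if Q n z.1 (ζ ⁻¹' {k}) ≠ 0 then ∫⁻ θ, F θ z.2 ∂((Q n z.1)[|ζ ⁻¹' {k}])
          else F hne.some z.2 := by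
      intro Y _ F hF
      refine Measurable.ite ?_ ?_ ?_
      · exact ((hQk.comp measurable_fst) (measurableSet_singleton 0)).compl
      · simp only [ProbabilityTheory.cond, lintegral_smul_measure, smul_eq_mul]
        refine (hQk.comp measurable_fst).inv.mul ?_
        simp_rw [← lintegral_indicator (hm k)]
        exact measurable_lintegral_param (κ := fun z : M.Hist n × Y => Q n z.1)
          ((Q n).measurable.comp measurable_fst)
          (f := fun z θ => (ζ ⁻¹' {k}).indicator (fun θ => F θ z.2) θ)
          ((hF.comp (f := fun w : (M.Hist n × Y) × M.Θ => (w.2, w.1.2)) (by fun_prop)).indicator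
            (measurable_snd (hm k)))
      · exact hF.comp (f := fun z : M.Hist n × Y => (hne.some, z.2)) (by fun_prop)
    intro h
    constructor
    · convert hcond (fun θ (y : S × A × S) => (M.env θ h).1.dens y.1 y.2.1 y.2.2)
        (M.measurableEnvFamily_env h).1 using 2 with z
      by_cases hz : Q n z.1 (ζ ⁻¹' {k}) ≠ 0
      · rw [if_pos hz]
        exact ((hmean z.1 k hz) h _ _).1 _
      · simp only [E, dif_neg hz, if_neg hz]
    · convert hcond (fun θ (y : S × A × ℝ) => (M.env θ h).2.dens y.1 y.2.1 y.2.2)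
        (M.measurableEnvFamily_env h).2 using 2 with z
      by_cases hz : Q n z.1 (ζ ⁻¹' {k}) ≠ 0
      · rw [if_pos hz]
        exact ((hmean z.1 k hz) h _ _).2 _
      · simp only [E, dif_neg hz, if_neg hz]
  filter_upwards [hQ.ae_eq_smul_withDensity n] with d ⟨C, hC0, _, hC⟩
  have hret : ∀ k, Q n d (ζ ⁻¹' {k}) ≠ 0 → ∀ π, lreturn (E d k) π M.s₁ =
      ∫⁻ θ, lreturn (M.env θ) π M.s₁ ∂((Q n d)[|ζ ⁻¹' {k}]) := fun k hk π => by
    obtain ⟨κ, hκ, hpi⟩ := exists_cond_eq_pi hζ.1 hlay hC0 hC k hk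
    have h := hmean d k hk
    rw [hpi] at h ⊢
    exact h.lreturn_eq π M.s₁
  have hv := measurable_lreturn_prod (M := M) M.measurableEnvFamily_env
  have hvl : ∀ π : Policy S M.μA H, Measurable fun θ => lreturn (M.env θ) π M.s₁ := fun π =>
    (measurable_lreturn M.measurableEnvFamily_env (measurablePolicyFamily_const π)).comp
      (f := fun θ : M.Θ => (θ, M.s₁)) (by fun_prop)
  refine tsRegret_sub_surrogateRegret_le hζ.1 _ ?_ fun k => ?_
  · have hpos : ∀ᵐ θ ∂(Q n d), ∀ k, Q n d (ζ ⁻¹' {k}) = 0 → ζ θ ≠ k :=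
      ae_all_iff.2 fun k => by
        by_cases hk : Q n d (ζ ⁻¹' {k}) = 0
        · filter_upwards [measure_eq_zero_iff_ae_notMem.1 hk] with θ hθ _ using hθ
        · exact ae_of_all _ fun θ h => absurd h hk
    filter_upwards [hpos] with θ hθ
    have hk : Q n d (ζ ⁻¹' {ζ θ}) ≠ 0 := fun h => hθ _ h rfl
    have := cond_isProbabilityMeasure hk
    have hi : Integrable (fun θ' => (lreturn (M.env θ') (M.opt θ) M.s₁).toReal)
        ((Q n d)[|ζ ⁻¹' {ζ θ}]) := by
      refine integrable_toReal_of_lintegral_ne_top (hvl _).aemeasurable ?_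
      rw [← hret _ hk]
      exact lreturn_ne_top _ _ _
    rw [V_eq M (E d (ζ θ)), hret _ hk, ← integral_toReal (hvl _).aemeasurable
      (ae_of_all _ fun _ => (lreturn_ne_top _ _ _).lt_top)]
    -- The partition bound holds against each `θ'` of the cell with the policy of `θ` fixed, and so
    -- survives averaging over `θ'`.
    have hae : ∀ᵐ θ' ∂((Q n d)[|ζ ⁻¹' {ζ θ}]),
        M.V (M.env θ) (M.opt θ) - ε ≤ (lreturn (M.env θ') (M.opt θ) M.s₁).toReal := by
      filter_upwards [ae_cond_mem (hm (ζ θ))] with θ' hθ'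
      have h := hζ.2 θ θ' (Eq.symm hθ')
      rw [V_eq M (M.env θ')] at h
      linarith
    have h := integral_mono_ae (integrable_const _) hi hae
    simp only [integral_const, probReal_univ, one_smul] at h
    linarith
  · by_cases hk : Q n d (ζ ⁻¹' {k}) = 0
    · rw [setLIntegral_measure_zero _ _ hk]
      exact zero_le
    · have := cond_isProbabilityMeasure hk
      rw [lintegral_const, Measure.restrict_apply_univ]
      simp_rw [hret k hk]
      -- After exchanging the integrals and cancelling the mass of the cell, the two sides coincide.
      have hswap : Measurable fun z : M.Θ × M.Θ => lreturn (M.env z.2) (M.opt z.1) M.s₁ :=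
        hv.comp measurable_swap
      rw [lintegral_lintegral_swap hswap.aemeasurable, ProbabilityTheory.cond,
        lintegral_smul_measure, smul_eq_mul, mul_comm, ← mul_assoc, ENNReal.mul_inv_cancel hk (measure_ne_top _ _), one_mul]

end BayesianRL

theorem lemma2 {S A : Type*} [MeasurableSpace S] [MeasurableSpace A] {H : ℕ}
    (M : BayesianRL S A H)
    (Q : ∀ n, Kernel (M.Hist n) M.Θ) (hQ : M.IsPosterior Q)
    (ε : ℝ) (hε : 0 < ε) {K : ℕ} (ζ : M.Θ → Fin K) (hζ : M.IsValuePartition ε ζ) (n : ℕ) :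
    -- surrogate environments in `Θ`, for every partition
    (∃ E : M.Hist n → Fin K → M.Θ,
      (∀ k, Measurable fun d => E d k) ∧
      (∀ d θ, ζ (E d (ζ θ)) = ζ θ) ∧
      ∀ᵐ d ∂(M.histLaw Q n),
        M.tsRegret (Q n d) - M.surrogateRegret (Q n d) ζ (fun k => M.env (E d k)) ≤ ε) ∧
    -- the posterior means over the cells, for every layered partition
    (M.IsLayered ζ →
      ∃ E : M.Hist n → Fin K → Env A M.μS H,
        (∀ k, M.MeasurableEnv fun d => E d k) ∧
        (∀ d k, Q n d (ζ ⁻¹' {k}) ≠ 0 → M.IsMeanEnv ((Q n d)[|ζ ⁻¹' {k}]) (E d k)) ∧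
        ∀ᵐ d ∂(M.histLaw Q n),
          M.tsRegret (Q n d) - M.surrogateRegret (Q n d) ζ (E d) ≤ ε) := by
  exact ⟨BayesianRL.exists_surrogate_mem hQ hζ n,
    fun hlay => BayesianRL.exists_surrogate_mean hQ hζ hlay n⟩
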